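/- Let $a>0$ and let $V:\mathbf R\to\mathbf C$ satisfy $e^{2a|x|}V\in L^2(\mathbf R)$. Put $H=-d^2/dx^2$ and consider $T=H+V$. Represent a point $\lambda$ of the Riemann surface of $\sqrt\lambda$ by $k=\sqrt\lambda\in\mathbf C$. The first sheet $P_1=\{-2\pi<\arg\lambda<0\}$ is $\{\operatorname{Im}k<0\}$, and $P(a)=\{-a<\operatorname{Im}\sqrt\lambda<a\}$ is the strip $\{|\operatorname{Im}k|<a\}$, whose branch point $\lambda=0$ is $k=0$. Write $\sqrt{-\lambda}=ik$, so that $\operatorname{Re}\sqrt{-\lambda}>0$ on $P_1$. **Evans function.** For $\lambda\in P_1$ let $\mu_\pm(\cdot,\lambda)$ be the solutions of $\mu''+(\lambda-V)\mu=0$ on $\mathbf R$ ($\mu$ differentiable, $\mu'$ a primitive of $(V-\lambda)\mu$) with $$(\mu_+,\mu_+')\,e^{\sqrt{-\lambda}\,x}\to(1,-\sqrt{-\lambda})\ (x\to\infty),\qquad(\mu_-,\mu_-')\,e^{-\sqrt{-\lambda}\,x}\to(1,\sqrt{-\lambda})\ (x\to-\infty),$$ and let $\mathbb E(\lambda)=\mu_+\mu_-'-\mu_+'\mu_-$.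 **Generalized eigenvalues.** Let $X=L^2(\mathbf R,e^{2a|x|}dx)$. For $\psi\in X$ let $\mathcal F\psi(\zeta)=(2\pi)^{-1/2}\int_{\mathbf R}\psi(x)e^{-ix\zeta}dx$ for $|\operatorname{Im}\zeta|<a$. For $k\ne0$ with $\operatorname{Im}k<a$ and $\lambda=k^2$, let $A(\lambda)\psi$ be the continuation of the free resolvent: for $\operatorname{Im}k<0$, $$A(\lambda)\psi(x)=(\lambda-H)^{-1}\psi(x)=\frac1{\sqrt{2\pi}}\int_{\mathbf R}\frac{e^{ix\xi}}{\lambda-\xi^2}\mathcal F\psi(\xi)\,d\xi;$$ for $\operatorname{Im}k=0$, $A(\lambda)\psi(x)$ is the limit of these values from $P_1$; and for $0<\operatorname{Im}k<a$, $$A(\lambda)\psi(x)=(\lambda-H)^{-1}\psi(x)+\frac{\pi i}{\sqrt{2\pi}\,k}\left(e^{ikx}\mathcal F\psi(k)+e^{-ikx}\mathcal F\psi(-k)\right).$$ Such a point $\lambda$ is a *generalized eigenvalue* of $T$ if $\phi\mapsto\phi-V\,A(\lambda)\phi$ is not injective on $X$. **Corollary 4.2.** For every $\lambda\in P_1$ the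 solutions $\mu_+$ and $\mu_-$ exist and are unique, and their Wronskian $\mathbb E(\lambda)$ does not depend on $x$. The Evans function $\mathbb E$ has an analytic continuation from $P_1$ to $P_1\cup P(a)$, in the coordinate $k=\sqrt\lambda$ (including $k=0$). For every $\lambda\neq0$ in $P_1\cup P(a)$, this continuation vanishes at $\lambda$ if and only if $\lambda$ is a generalized eigenvalue of $T$. -/

import Mathlib

open MeasureTheory Filter Topology

namespace EvansFunction

noncomputable section

/-! A point of the Riemann surface of `√lam` is represented by the value `k = √lam`, so that the
spectral parameter is `lam = k ^ 2`. Since `√lam = k`, the branch of `√(-lam)` with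
`Re √(-lam) > 0` on the first sheet is `I * k`. -/

/-- The first Riemann sheet `-2π < arg lam < 0`, that is `Im √lam < 0`. -/
def firstSheet : Set ℂ := {k | k.im < 0}

/-- The Riemann surface `P(a) = {lam | -a < Im √lam < a}`, in the coordinate `k = √lam`. -/
def surfaceP (a : ℝ) : Set ℂ := {k | -a < k.im ∧ k.im < a}

/-- `u` solves `u'' + (k ^ 2 - V) u = 0` on `ℝ` in the Carathéodory sense: `u` is differentiable and
`u'` is a primitive of `(V - k ^ 2) u` (the potential is only locally integrable). -/
structure IsSolution (V : ℝ → ℂ) (k : ℂ) (u : ℝ → ℂ) : Prop where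
  differentiable : Differentiable ℝ u
  integrated : ∀ x y : ℝ, deriv u y - deriv u x = ∫ t in x..y, (V t - k ^ 2) * u t

/-- `u = μ₊(·, lam)`: the solution with `(u, u') e^{√(-lam) x} → (1, -√(-lam))` as `x → ∞`. -/
structure IsMuPlus (V : ℝ → ℂ) (k : ℂ) (u : ℝ → ℂ) : Prop where
  solution : IsSolution V k u
  value : Tendsto (fun x : ℝ => u x * Complex.exp (Complex.I * k * x)) atTop (𝓝 1)
  slope : Tendsto (fun x : ℝ => deriv u x * Complex.exp (Complex.I * k * x)) atTop
    (𝓝 (-(Complex.I * k)))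

/-- `u = μ₋(·, lam)`: the solution with `(u, u') e^{-√(-lam) x} → (1, √(-lam))` as `x → -∞`. -/
structure IsMuMinus (V : ℝ → ℂ) (k : ℂ) (u : ℝ → ℂ) : Prop where
  solution : IsSolution V k u
  value : Tendsto (fun x : ℝ => u x * Complex.exp (-(Complex.I * k * x))) atBot (𝓝 1)
  slope : Tendsto (fun x : ℝ => deriv u x * Complex.exp (-(Complex.I * k * x))) atBot
    (𝓝 (Complex.I * k))

/-- The Wronskian `u v' - u' v` at `x`. -/
def wronskian (u v : ℝ → ℂ) (x : ℝ) : ℂ := u x * deriv v x - deriv u x * v x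

/-- The measure `e^{2 a |x|} dx` on `ℝ`. -/
def weightedVolume (a : ℝ) : Measure ℝ :=
  volume.withDensity (fun x => ENNReal.ofReal (Real.exp (2 * a * |x|)))

/-- The test space `X = L²(ℝ, e^{2 a |x|} dx)` of the rigged Hilbert space. -/
abbrev testSpace (a : ℝ) : Type := Lp ℂ 2 (weightedVolume a)

/-- The Fourier transform `(2π)^{-1/2} ∫ ψ(x) e^{-i x ζ} dx` at a complex frequency `ζ`. For `ψ` in
`L²(ℝ, e^{2 a |x|} dx)` the integral converges absolutely when `|Im ζ| < a`. -/
def fourier (ψ : ℝ → ℂ) (ζ : ℂ) : ℂ :=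
  (1 / Real.sqrt (2 * Real.pi) : ℝ) * ∫ x : ℝ, ψ x * Complex.exp (-(Complex.I * x * ζ))

/-- The resolvent `(lam - H)⁻¹ ψ` of `H = -d²/dx²`, for `lam` outside `[0, ∞)`. -/
def freeResolvent (lam : ℂ) (ψ : ℝ → ℂ) (x : ℝ) : ℂ :=
  (1 / Real.sqrt (2 * Real.pi) : ℝ) *
    ∫ ξ : ℝ, (lam - (ξ : ℂ) ^ 2)⁻¹ * Complex.exp (Complex.I * x * ξ) * fourier ψ ξ

/-- The continuation `A(lam)` of the resolvent of `H` from the first sheet: the resolvent itself on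
the first sheet, its boundary value from the first sheet on the cut `Im √lam = 0`, and the resolvent
plus the residue term `(π i / √(2π)) (√lam)⁻¹ ∑_{ω = ±1} e^{i √lam x ω} ψ̂(√lam ω)` on the second
sheet (it is used for `k ≠ 0`, `Im k < a`, and `ψ` in `L²(ℝ, e^{2 a |x|} dx)`). -/
def continuedResolvent (k : ℂ) (ψ : ℝ → ℂ) (x : ℝ) : ℂ :=
  if k.im < 0 then freeResolvent (k ^ 2) ψ x
  else if k.im = 0 then limUnder (𝓝[firstSheet] k) (fun z : ℂ => freeResolvent (z ^ 2) ψ x)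
  else freeResolvent (k ^ 2) ψ x +
    Real.pi * Complex.I / (Real.sqrt (2 * Real.pi) : ℝ) * k⁻¹ *
      (Complex.exp (Complex.I * k * x) * fourier ψ k +
        Complex.exp (-(Complex.I * k * x)) * fourier ψ (-k))

/-- `lam = k ^ 2` is a generalized eigenvalue (resonance pole) of `-d²/dx² + V`: the linear operator
`id - K^× A(lam)`, where `K^×` is multiplication by `V`, is not injective on
`X = L²(ℝ, e^{2 a |x|} dx)`. Such a point belongs to the generalized spectrum, because the
generalized resolvent `A(lam) (id - K^× A(lam))⁻¹` does not exist there. -/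
def IsGeneralizedEigenvalue (a : ℝ) (V : ℝ → ℂ) (k : ℂ) : Prop :=
  ∃ φ : testSpace a, φ ≠ 0 ∧
    ∀ᵐ x : ℝ, (φ : ℝ → ℂ) x - V x * continuedResolvent k (φ : ℝ → ℂ) x = 0

end

end EvansFunction

open scoped FourierTransform

namespace EvansFunction

/-! Put `κ = I * k`, so that the first sheet is `Re κ > 0` and the whole domain is `Re κ > -a`. By
Cauchy–Schwarz, `e^{2b|x|} V` is integrable for every `b < a`; the analysis is done on the
half-plane `Re κ > -b`.

Existence and continuation. The amplitude `m = e^{κx} μ₊` solves the Volterra equation `m(x) = 1 +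
∫_x^∞ (1 - e^{-2κ(y-x)})/(2κ) V(y) m(y) dy`. Its kernel is entire in `κ`, also at `κ = 0`, and grows
at most like `e^{2b(y-x)}`, which the decay of `V` absorbs. The Neumann series therefore converges
factorially and locally uniformly in `κ`, and `μ₊` and its derivative are holomorphic in `κ`; `μ₋`
comes from the reflection `x ↦ -x`. Their Wronskian is the continued Evans function
(`differentiableOn_evans`).

Zeros. For `Re κ < 0` the asymptotics of `μ₊` no longer determine it, since a decaying solution may
be added. The substitute is the integrated equation `u' + κu = -∫_x^∞ e^{-κ(y-x)} V u`
(`IsRightJost`): any two functions satisfying it, with the stated bounds, have zero Wronskian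
(`IsRightJost.wronskian_eq_zero`). On both sheets and on the cut, `A(lam)` is the Green operator
with kernel `-e^{-κ|x-y|}/(2κ)` (`continuedResolvent_eq_greenIntegral`). If `φ = V A φ`, then `u = A
φ` satisfies the integrated equation at both ends, so it is proportional to `μ₊` and to `μ₋`, and
their Wronskian vanishes. Conversely, if `μ₊ = c μ₋`, then `μ₊` satisfies both equations; adding
them gives `A(V μ₊) = μ₊`, and `φ = V μ₊` is a nonzero element of `X` in the kernel. -/

/-! ### Primitives of locally integrable functions. -/

theorem intervalIntegrable_of_locallyIntegrable {E : Type*} [NormedAddCommGroup E] {f : ℝ → E}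
    (hf : LocallyIntegrable f volume) (x y : ℝ) : IntervalIntegrable f volume x y :=
  (hf.integrableOn_isCompact isCompact_uIcc).intervalIntegrable

/-- `f` is a primitive of the locally integrable function `f'`. -/
structure IsPrimitive {𝕜 : Type*} [RCLike 𝕜] (f f' : ℝ → 𝕜) : Prop where
  locallyIntegrable : LocallyIntegrable f' volume
  sub_eq : ∀ x y : ℝ, f y - f x = ∫ t in x..y, f' t

namespace IsPrimitive

variable {𝕜 : Type*} [RCLike 𝕜] {f f' g g' : ℝ → 𝕜}

theorem intervalIntegrable (hf : IsPrimitive f f') (x y : ℝ) :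
    IntervalIntegrable f' volume x y :=
  intervalIntegrable_of_locallyIntegrable hf.locallyIntegrable x y

theorem _root_.EvansFunction.isPrimitive_intervalIntegral (hf : LocallyIntegrable f volume)
    (c : ℝ) : IsPrimitive (fun x => ∫ t in c..x, f t) f :=
  ⟨hf, fun _ _ => intervalIntegral.integral_interval_sub_left
    (intervalIntegrable_of_locallyIntegrable hf _ _)
    (intervalIntegrable_of_locallyIntegrable hf _ _)⟩

theorem eq_add (hf : IsPrimitive f f') (c x : ℝ) : f x = f c + ∫ t in c..x, f' t := by
  rw [← hf.sub_eq]; ring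

theorem continuous (hf : IsPrimitive f f') : Continuous f := by
  have : f = fun x => f 0 + ∫ t in (0 : ℝ)..x, f' t := funext fun x => hf.eq_add 0 x
  rw [this]
  exact continuous_const.add
    (intervalIntegral.continuous_primitive (fun a b => hf.intervalIntegrable a b) 0)

theorem ae_hasDerivAt (hf : IsPrimitive f f') : ∀ᵐ x, HasDerivAt f (f' x) x := by
  filter_upwards [LocallyIntegrable.ae_hasDerivAt_integral hf.locallyIntegrable] with x hx
  have : f = fun x => f 0 + ∫ t in (0 : ℝ)..x, f' t := funext fun x => hf.eq_add 0 x
  rw [this]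
  exact (hx 0).const_add _

theorem hasDerivAt (hf : IsPrimitive f f') (hc : Continuous f') (x : ℝ) :
    HasDerivAt f (f' x) x := by
  have : f = fun x => f 0 + ∫ t in (0 : ℝ)..x, f' t := funext fun x => hf.eq_add 0 x
  rw [this]
  exact (intervalIntegral.integral_hasDerivAt_right (hc.intervalIntegrable _ _)
    hc.stronglyMeasurable.stronglyMeasurableAtFilter hc.continuousAt).const_add _

/-- Each increment of `f` is at most the corresponding increment of the real primitive `∫ ‖f'‖`, so
absolute continuity passes from that primitive to `f`. -/
theorem absolutelyContinuousOnInterval (hf : IsPrimitive f f') (a b : ℝ) :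
    AbsolutelyContinuousOnInterval f a b := by
  have hn : IntervalIntegrable (fun t => ‖f' t‖) volume a b := (hf.intervalIntegrable a b).norm
  have h := hn.absolutelyContinuousOnInterval_intervalIntegral (c := a) (by simp)
  unfold AbsolutelyContinuousOnInterval at h ⊢
  refine squeeze_zero (fun E => Finset.sum_nonneg fun _ _ => dist_nonneg) (fun E => ?_) h
  refine Finset.sum_le_sum fun i _ => ?_
  have hi : ∀ x y, IntervalIntegrable (fun t => ‖f' t‖) volume x y :=
    fun x y => (hf.intervalIntegrable x y).norm
  rw [dist_comm, dist_eq_norm, hf.sub_eq, dist_comm, Real.dist_eq,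
    intervalIntegral.integral_interval_sub_left (hi _ _) (hi _ _)]
  exact intervalIntegral.norm_integral_le_abs_integral_norm

/-- The difference of `f` and a primitive of `f'` is absolutely continuous with derivative zero
almost everywhere, hence constant. This gives the product rule without continuity of the
derivatives. -/
theorem of_absolutelyContinuousOnInterval
    (hf : ∀ a b, AbsolutelyContinuousOnInterval f a b) (hi : LocallyIntegrable f' volume)
    (hd : ∀ᵐ x, HasDerivAt f (f' x) x) : IsPrimitive f f' := by
  refine ⟨hi, fun x y => ?_⟩
  have hp : IsPrimitive (fun z => ∫ t in x..z, f' t) f' :=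
    isPrimitive_intervalIntegral hi x
  have hac := (hf x y).sub (hp.absolutelyContinuousOnInterval x y)
  obtain ⟨C, hC⟩ := hac.const_of_ae_hasDerivAt_zero (by
    filter_upwards [hd, hp.ae_hasDerivAt] with z h1 h2 _
    simpa using h1.sub h2)
  have h1 := hC x (by simp)
  have h2 := hC y (by simp)
  simp only [Pi.sub_apply, intervalIntegral.integral_same, sub_zero] at h1 h2
  rw [h1, ← h2]; ring

theorem congr (hf : IsPrimitive f f') (h : f' =ᵐ[volume] g') : IsPrimitive f g' := by
  refine ⟨?_, fun x y => ?_⟩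
  · intro x
    obtain ⟨s, hs, hi⟩ := hf.locallyIntegrable x
    exact ⟨s, hs, hi.congr_fun_ae (ae_restrict_of_ae h)⟩
  · rw [hf.sub_eq]
    exact intervalIntegral.integral_congr_ae (h.mono fun t ht _ => ht)

theorem congr' (hf : IsPrimitive f f') (h : ∀ x, f x = g x) (h' : ∀ x, f' x = g' x) :
    IsPrimitive g g' := by
  rw [← funext h, ← funext h']; exact hf

theorem _root_.EvansFunction.isPrimitive_const (c : 𝕜) : IsPrimitive (fun _ => c) (fun _ => 0) :=
  ⟨(continuous_const).locallyIntegrable, fun _ _ => by simp⟩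

theorem _root_.EvansFunction.isPrimitive_of_hasDerivAt (h : ∀ x, HasDerivAt f (f' x) x)
    (hc : Continuous f') : IsPrimitive f f' :=
  ⟨hc.locallyIntegrable, fun _ _ =>
    (intervalIntegral.integral_eq_sub_of_hasDerivAt (fun t _ => h t)
      (hc.intervalIntegrable _ _)).symm⟩

theorem add (hf : IsPrimitive f f') (hg : IsPrimitive g g') :
    IsPrimitive (fun x => f x + g x) (fun x => f' x + g' x) :=
  ⟨hf.locallyIntegrable.add hg.locallyIntegrable, fun x y => by
    rw [intervalIntegral.integral_add (hf.intervalIntegrable x y) (hg.intervalIntegrable x y),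
      ← hf.sub_eq, ← hg.sub_eq]; ring⟩

theorem mul (hf : IsPrimitive f f') (hg : IsPrimitive g g') :
    IsPrimitive (fun x => f x * g x) (fun x => f' x * g x + f x * g' x) := by
  refine of_absolutelyContinuousOnInterval (fun a b =>
    (hf.absolutelyContinuousOnInterval a b).smul (hg.absolutelyContinuousOnInterval a b)) ?_ ?_
  · refine LocallyIntegrable.add ?_ ?_
    · simpa [mul_comm] using hf.locallyIntegrable.continuous_smul hg.continuous
    · exact hg.locallyIntegrable.continuous_smul hf.continuous
  · filter_upwards [hf.ae_hasDerivAt, hg.ae_hasDerivAt] with x h1 h2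
    exact h1.mul h2

theorem const_mul (c : 𝕜) (hf : IsPrimitive f f') :
    IsPrimitive (fun x => c * f x) (fun x => c * f' x) :=
  ((isPrimitive_const c).mul hf).congr' (fun _ => rfl) (fun x => by simp)

theorem neg (hf : IsPrimitive f f') : IsPrimitive (fun x => - f x) (fun x => - f' x) :=
  (hf.const_mul (-1)).congr' (fun x => by simp) (fun x => by simp)

theorem sub (hf : IsPrimitive f f') (hg : IsPrimitive g g') :
    IsPrimitive (fun x => f x - g x) (fun x => f' x - g' x) :=
  (hf.add hg.neg).congr' (fun x => by ring) (fun x => by ring)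

theorem pow (hf : IsPrimitive f f') (n : ℕ) :
    IsPrimitive (fun x => f x ^ (n + 1)) (fun x => (n + 1) * f x ^ n * f' x) := by
  induction n with
  | zero => exact hf.congr' (fun x => by simp) (fun x => by simp)
  | succ n ih =>
    exact (ih.mul hf).congr' (fun x => by ring) (fun x => by push_cast; ring)

theorem eq_of_zero (hf : IsPrimitive f (fun _ => 0)) (x y : ℝ) : f x = f y := by
  have := hf.sub_eq y x
  simpa [sub_eq_zero] using this

theorem comp_neg (hf : IsPrimitive f f') : IsPrimitive (fun x => f (-x)) (fun x => - f' (-x)) := by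
  refine ⟨?_, fun x y => ?_⟩
  · have : LocallyIntegrable (fun x => f' (-x)) volume := by
      intro x
      obtain ⟨s, hs, hi⟩ := hf.locallyIntegrable (-x)
      exact ⟨Neg.neg ⁻¹' s, continuous_neg.continuousAt.preimage_mem_nhds hs,
        ((Measure.measurePreserving_neg volume).integrableOn_comp_preimage
          (Homeomorph.neg ℝ).measurableEmbedding).2 hi⟩
    exact this.neg
  · rw [intervalIntegral.integral_neg, intervalIntegral.integral_comp_neg,
      ← intervalIntegral.integral_symm, hf.sub_eq]

end IsPrimitive

/-! ### Tail integrals and Gronwall's inequality. -/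

theorem isPrimitive_integral_Ioi {𝕜 : Type*} [RCLike 𝕜] {f : ℝ → 𝕜}
    (hf : ∀ x, IntegrableOn f (Set.Ioi x)) :
    IsPrimitive (fun x => ∫ y in Set.Ioi x, f y) (fun x => - f x) := by
  have hl : LocallyIntegrable f volume := by
    intro x
    exact ⟨Set.Ioi (x - 1), Ioi_mem_nhds (by linarith), hf _⟩
  refine ⟨hl.neg, fun x y => ?_⟩
  rw [intervalIntegral.integral_neg, ← intervalIntegral.integral_Ioi_sub_Ioi' (hf x) (hf y)]
  ring

theorem tendsto_integral_Ioi {𝕜 : Type*} [RCLike 𝕜] {f : ℝ → 𝕜} {c : ℝ}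
    (hf : IntegrableOn f (Set.Ioi c)) :
    Tendsto (fun x => ∫ y in Set.Ioi x, f y) atTop (𝓝 0) := by
  have h := intervalIntegral_tendsto_integral_Ioi c hf tendsto_id
  have h2 : Tendsto (fun x => (∫ y in Set.Ioi c, f y) - ∫ y in c..x, f y) atTop (𝓝 0) := by
    simpa using h.const_sub (∫ y in Set.Ioi c, f y)
  refine h2.congr' ?_
  filter_upwards [eventually_ge_atTop c] with x hx
  rw [← intervalIntegral.integral_Ioi_sub_Ioi' hf (hf.mono_set (Set.Ioi_subset_Ioi hx))]
  ring

/-- Integral form of Gronwall's inequality with an integrable coefficient. -/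
theorem eq_zero_of_le_integral_mul {f q : ℝ → ℝ} {c : ℝ} (hf : Continuous f) (hf0 : ∀ x, 0 ≤ f x)
    (hq : LocallyIntegrable q volume) (hq0 : ∀ x, 0 ≤ q x)
    (h : ∀ x, c ≤ x → f x ≤ ∫ t in c..x, q t * f t) {x : ℝ} (hx : c ≤ x) : f x = 0 := by
  set Q : ℝ → ℝ := fun x => ∫ t in c..x, q t with hQ
  have hQp : IsPrimitive Q q := isPrimitive_intervalIntegral hq c
  obtain ⟨M, hM⟩ := (isCompact_Icc (a := c) (b := x)).exists_bound_of_continuousOn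
    hf.continuousOn
  -- Feeding the bound back into the hypothesis integrates `Q ^ n * Q'`, which produces the
  -- factorial; letting `n → ∞` forces `f x = 0`.
  have key : ∀ n : ℕ, ∀ y ∈ Set.Icc c x, f y ≤ M * (Q y ^ n / n.factorial) := by
    intro n
    induction n with
    | zero =>
      intro y hy
      have := hM y hy
      rw [Real.norm_of_nonneg (hf0 y)] at this
      simpa using this
    | succ n ih =>
      intro y hy
      have hcont : Continuous fun t => M * (Q t ^ n / n.factorial) := by
        have := hQp.continuous
        fun_prop
      calc f y ≤ ∫ t in c..y, q t * f t := h y hy.1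
        _ ≤ ∫ t in c..y, q t * (M * (Q t ^ n / n.factorial)) := by
          refine intervalIntegral.integral_mono_on hy.1 ?_ ?_ ?_
          · exact (hQp.intervalIntegrable _ _).mul_continuousOn hf.continuousOn
          · exact (hQp.intervalIntegrable _ _).mul_continuousOn hcont.continuousOn
          · intro t ht
            exact mul_le_mul_of_nonneg_left (ih t ⟨ht.1, ht.2.trans hy.2⟩) (hq0 t)
        _ = ∫ t in c..y, (M / (n + 1).factorial) * ((n + 1) * Q t ^ n * q t) := by
          congr 1; ext t
          rw [Nat.factorial_succ]; push_cast
          have : (n.factorial : ℝ) ≠ 0 := by positivity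
          field_simp
        _ = M * (Q y ^ (n + 1) / (n + 1).factorial) := by
          rw [intervalIntegral.integral_const_mul, ← (hQp.pow n).sub_eq c y]
          simp [hQ]; ring
  have hlim : Tendsto (fun n : ℕ => M * (Q x ^ n / n.factorial)) atTop (𝓝 0) := by
    simpa using (FloorSemiring.tendsto_pow_div_factorial_atTop (Q x)).const_mul M
  exact le_antisymm (ge_of_tendsto' hlim fun n => key n x ⟨hx, le_rfl⟩) (hf0 x)

/-! ### Carathéodory solutions: reflection, Wronskian, uniqueness of the initial value problem. -/

section Solutions

variable {V : ℝ → ℂ} {k : ℂ} {u v : ℝ → ℂ}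

theorem locallyIntegrable_potential_mul (hV : LocallyIntegrable V volume) (k : ℂ)
    (hu : Continuous u) : LocallyIntegrable (fun t => (V t - k ^ 2) * u t) volume := by
  have h : LocallyIntegrable (fun t => V t - k ^ 2) volume :=
    hV.sub (continuous_const.locallyIntegrable)
  simpa [mul_comm] using h.continuous_smul hu

theorem IsSolution.isPrimitive_deriv (hV : LocallyIntegrable V volume) (hu : IsSolution V k u) :
    IsPrimitive (deriv u) (fun t => (V t - k ^ 2) * u t) :=
  ⟨locallyIntegrable_potential_mul hV k hu.differentiable.continuous, hu.integrated⟩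

theorem IsSolution.isPrimitive (hV : LocallyIntegrable V volume) (hu : IsSolution V k u) :
    IsPrimitive u (deriv u) :=
  isPrimitive_of_hasDerivAt (fun x => (hu.differentiable x).hasDerivAt)
    (hu.isPrimitive_deriv hV).continuous

theorem IsSolution.of_isPrimitive {w : ℝ → ℂ} (h1 : IsPrimitive u w)
    (h2 : IsPrimitive w (fun t => (V t - k ^ 2) * u t)) : IsSolution V k u := by
  have h : ∀ x, HasDerivAt u (w x) x := h1.hasDerivAt h2.continuous
  have hd : deriv u = w := funext fun x => (h x).deriv
  exact ⟨fun x => (h x).differentiableAt, fun x y => by rw [hd]; exact h2.sub_eq x y⟩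

theorem IsSolution.sub_const_mul (hV : LocallyIntegrable V volume) (hu : IsSolution V k u)
    (hv : IsSolution V k v) (c : ℂ) : IsSolution V k (fun x => u x - c * v x) :=
  .of_isPrimitive ((hu.isPrimitive hV).sub ((hv.isPrimitive hV).const_mul c))
    (((hu.isPrimitive_deriv hV).sub ((hv.isPrimitive_deriv hV).const_mul c)).congr'
      (fun _ => rfl) (fun x => by ring))

theorem deriv_sub_const_mul (hu : Differentiable ℝ u) (hv : Differentiable ℝ v) (c : ℂ) (x : ℝ) :
    deriv (fun x => u x - c * v x) x = deriv u x - c * deriv v x :=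
  ((hu x).hasDerivAt.sub ((hv x).hasDerivAt.const_mul c)).deriv

theorem deriv_comp_neg_apply (u : ℝ → ℂ) (x : ℝ) :
    deriv (fun x => u (-x)) x = - deriv u (-x) := deriv_comp_neg u x

/-- The equation has no first-order term, so reflection only replaces `V` by `V (-x)`. Every
statement at `-∞` is obtained from its counterpart at `+∞` in this way. -/
theorem IsSolution.comp_neg (hV : LocallyIntegrable V volume) (hu : IsSolution V k u) :
    IsSolution (fun x => V (-x)) k (fun x => u (-x)) :=
  .of_isPrimitive (hu.isPrimitive hV).comp_neg
    ((hu.isPrimitive_deriv hV).comp_neg.neg.congr' (fun _ => rfl) (fun x => by ring))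

theorem locallyIntegrable_comp_neg (hV : LocallyIntegrable V volume) :
    LocallyIntegrable (fun x => V (-x)) volume := by
  have hp : IsPrimitive (fun z => ∫ t in (0 : ℝ)..z, V t) V :=
    isPrimitive_intervalIntegral hV 0
  simpa using hp.comp_neg.neg.locallyIntegrable

theorem wronskian_eq (hV : LocallyIntegrable V volume) (hu : IsSolution V k u)
    (hv : IsSolution V k v) (x y : ℝ) : wronskian u v x = wronskian u v y := by
  have h := ((hu.isPrimitive hV).mul (hv.isPrimitive_deriv hV)).sub
    ((hu.isPrimitive_deriv hV).mul (hv.isPrimitive hV))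
  exact (h.congr' (g := wronskian u v) (g' := fun _ => 0) (fun _ => rfl)
    (fun x => by ring)).eq_of_zero x y

/-- Gronwall for `‖u‖ + ‖u'‖`: the first-order system for `(u, u')` has coefficients dominated by `1
+ ‖V - k ^ 2‖`, which is only locally integrable. -/
theorem IsSolution.eq_zero_of_le (hV : LocallyIntegrable V volume) (hu : IsSolution V k u)
    {c : ℝ} (h0 : u c = 0) (h1 : deriv u c = 0) {x : ℝ} (hx : c ≤ x) : u x = 0 := by
  have hp := hu.isPrimitive hV
  have hp' := hu.isPrimitive_deriv hV
  set f : ℝ → ℝ := fun x => ‖u x‖ + ‖deriv u x‖ with hf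
  set q : ℝ → ℝ := fun x => 1 + ‖V x - k ^ 2‖ with hq
  have hfc : Continuous f := hp.continuous.norm.add hp'.continuous.norm
  have hql : LocallyIntegrable q volume :=
    (continuous_const.locallyIntegrable).add
      (fun x => (hV.sub (continuous_const.locallyIntegrable) x).norm)
  have hq0 : ∀ x, 0 ≤ q x := fun x => by positivity
  have := eq_zero_of_le_integral_mul (f := f) (q := q) (c := c) hfc (fun x => by positivity)
    hql hq0 ?_ hx
  · have h2 : ‖u x‖ ≤ f x := by simp [hf]
    rw [this] at h2
    exact norm_le_zero_iff.1 h2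
  · intro y hy
    have e1 : ‖u y‖ ≤ ∫ t in c..y, ‖deriv u t‖ := by
      have := hp.sub_eq c y
      rw [h0, sub_zero] at this
      rw [this]
      exact intervalIntegral.norm_integral_le_integral_norm hy
    have e2 : ‖deriv u y‖ ≤ ∫ t in c..y, ‖(V t - k ^ 2) * u t‖ := by
      have := hp'.sub_eq c y
      rw [h1, sub_zero] at this
      rw [this]
      exact intervalIntegral.norm_integral_le_integral_norm hy
    calc f y ≤ (∫ t in c..y, ‖deriv u t‖) + ∫ t in c..y, ‖(V t - k ^ 2) * u t‖ := add_le_add e1 e2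
      _ = ∫ t in c..y, (‖deriv u t‖ + ‖(V t - k ^ 2) * u t‖) :=
        (intervalIntegral.integral_add (hp.intervalIntegrable c y).norm
          (hp'.intervalIntegrable c y).norm).symm
      _ ≤ ∫ t in c..y, q t * f t := by
        refine intervalIntegral.integral_mono_on hy
          ((hp.intervalIntegrable c y).norm.add (hp'.intervalIntegrable c y).norm)
          ((intervalIntegrable_of_locallyIntegrable hql _ _).mul_continuousOn hfc.continuousOn) fun t _ => ?_
        simp only [hq, hf, norm_mul]
        nlinarith [norm_nonneg (u t), norm_nonneg (deriv u t), norm_nonneg (V t - k ^ 2),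
          mul_nonneg (norm_nonneg (V t - k ^ 2)) (norm_nonneg (deriv u t))]

theorem IsSolution.eq_zero (hV : LocallyIntegrable V volume) (hu : IsSolution V k u)
    {c : ℝ} (h0 : u c = 0) (h1 : deriv u c = 0) (x : ℝ) : u x = 0 := by
  rcases le_total c x with hx | hx
  · exact hu.eq_zero_of_le hV h0 h1 hx
  · have := (hu.comp_neg hV).eq_zero_of_le (locallyIntegrable_comp_neg hV) (c := -c) (x := -x)
      (by simpa using h0) (by rw [deriv_comp_neg_apply]; simpa using h1) (by linarith)
    simpa using this

/-- Two solutions with vanishing Wronskian are linearly dependent. -/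
theorem exists_eq_const_mul_of_wronskian_eq_zero (hV : LocallyIntegrable V volume)
    (hu : IsSolution V k u) (hv : IsSolution V k v) {x₀ : ℝ} (hW : wronskian u v x₀ = 0)
    (hne : ∃ x, v x ≠ 0) : ∃ c : ℂ, ∀ x, u x = c * v x := by
  obtain ⟨x₁, hx₁⟩ := hne
  have hW1 : wronskian u v x₁ = 0 := by rw [wronskian_eq hV hu hv x₁ x₀, hW]
  -- This constant makes `u - c v` vanish at `x₁`; the zero Wronskian makes its derivative vanish
  -- there too.
  refine ⟨u x₁ / v x₁, fun x => ?_⟩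
  have := (hu.sub_const_mul hV hv (u x₁ / v x₁)).eq_zero hV (c := x₁) ?_ ?_ x
  · linear_combination this
  · field_simp; ring
  · rw [deriv_sub_const_mul hu.differentiable hv.differentiable]
    simp only [wronskian] at hW1
    field_simp
    linear_combination -hW1

end Solutions

/-! ### Holomorphic dependence of integrals on a parameter. -/

/-- A dominated integral of holomorphic functions is holomorphic. -/
theorem differentiableOn_integral_of_dominated {α : Type*} [MeasurableSpace α] {μ : Measure α}
    {U : Set ℂ} (hU : IsOpen U) {F : ℂ → α → ℂ} {bound : α → ℝ}
    (hm : ∀ z ∈ U, AEStronglyMeasurable (F z) μ)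
    (hd : ∀ᵐ y ∂μ, DifferentiableOn ℂ (fun z => F z y) U)
    (hb : ∀ᵐ y ∂μ, ∀ z ∈ U, ‖F z y‖ ≤ bound y) (hi : Integrable bound μ) :
    DifferentiableOn ℂ (fun z => ∫ y, F z y ∂μ) U := by
  intro z₀ hz₀
  obtain ⟨r, hr, hball⟩ := Metric.isOpen_iff.1 hU z₀ hz₀
  have hr2 : 0 < r / 2 := by positivity
  have hsub : ∀ z ∈ Metric.ball z₀ (r / 2), Metric.closedBall z (r / 4) ⊆ U := by
    intro z hz w hw
    apply hball
    rw [Metric.mem_ball] at hz ⊢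
    rw [Metric.mem_closedBall] at hw
    linarith [dist_triangle w z z₀]
  have hmem : ∀ z ∈ Metric.ball z₀ (r / 2), z ∈ U := fun z hz =>
    hsub z hz (Metric.mem_closedBall_self (by positivity))
  -- Cauchy's estimate on circles of radius `r / 4`, which stay in `U`, turns the bound on `F` into
  -- the bound `bound y / (r / 4)` on its derivative.
  refine ((hasDerivAt_integral_of_dominated_loc_of_deriv_le (F := F)
    (F' := fun z y => deriv (fun w => F w y) z) (bound := fun y => bound y / (r / 4))
    (Metric.ball_mem_nhds z₀ hr2) ?_ ?_ ?_ ?_ ?_ ?_).2).differentiableAt.differentiableWithinAt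
  · filter_upwards [Metric.ball_mem_nhds z₀ hr2] with z hz using hm z (hmem z hz)
  · exact hi.mono' (hm z₀ hz₀) (hb.mono fun y hy => hy z₀ hz₀)
  -- Measurability in `y` of the derivative at `z₀`: it is the almost everywhere limit of difference
  -- quotients along a sequence.
  · have hseq : ∃ s : ℕ → ℂ, Tendsto s atTop (𝓝[≠] z₀) := exists_seq_tendsto _
    obtain ⟨s, hs⟩ := hseq
    have hs2 : ∀ᶠ n in atTop, s n ∈ Metric.ball z₀ (r / 2) :=
      (hs.mono_right nhdsWithin_le_nhds).eventually (Metric.ball_mem_nhds z₀ hr2)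
    obtain ⟨N, hN⟩ := eventually_atTop.1 hs2
    refine aestronglyMeasurable_of_tendsto_ae atTop
      (f := fun n y => slope (fun w => F w y) z₀ (s (n + N))) (fun n => ?_) ?_
    · simp only [slope_def_field]
      have h1 := hm _ (hmem _ (hN (n + N) (by omega)))
      exact ((h1.sub (hm z₀ hz₀)).mul_const ((s (n + N) - z₀)⁻¹)).congr
        (Eventually.of_forall fun y => by simp [div_eq_mul_inv])
    · filter_upwards [hd] with y hy
      have := ((hy z₀ hz₀).differentiableAt (hU.mem_nhds hz₀)).hasDerivAt
      rw [hasDerivAt_iff_tendsto_slope] at this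
      exact this.comp (hs.comp (tendsto_add_atTop_nat N))
  · filter_upwards [hd, hb] with y hy hby z hz
    refine Complex.norm_deriv_le_of_forall_mem_sphere_norm_le (by positivity) ?_ ?_
    · refine DifferentiableOn.diffContOnCl ?_
      rw [closure_ball _ (by positivity)]
      exact hy.mono (hsub z hz)
    · intro w hw
      exact hby w (hsub z hz (Metric.sphere_subset_closedBall hw))
  · exact hi.div_const _
  · filter_upwards [hd] with y hy z hz
    exact ((hy z (hmem z hz)).differentiableAt (hU.mem_nhds (hmem z hz))).hasDerivAt

/-! ### The Volterra kernel: bounds and holomorphy. -/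

noncomputable section

/-- The kernel `(1 - e^{-2κt}) / (2κ)` for `t ≥ 0`, extended by zero. -/
def volterraKernel (κ : ℂ) (t : ℝ) : ℂ :=
  ∫ s in (0 : ℝ)..max t 0, Complex.exp (-(2 * κ * s))

/-- The terms of the Neumann series of the Volterra equation for the Jost amplitude. -/
def jostTerm (V : ℝ → ℂ) (κ : ℂ) : ℕ → ℝ → ℂ
  | 0, _ => 1
  | n + 1, x => ∫ y, volterraKernel κ (y - x) * V y * jostTerm V κ n y

/-- The amplitude `e^{κx} μ₊(x)`. -/
def jostAmplitude (V : ℝ → ℂ) (κ : ℂ) (x : ℝ) : ℂ := ∑' n, jostTerm V κ n x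

/-- The derivative of the Jost amplitude. -/
def jostSlope (V : ℝ → ℂ) (κ : ℂ) (x : ℝ) : ℂ :=
  -∫ y in Set.Ioi x, Complex.exp (-(2 * κ * (y - x))) * V y * jostAmplitude V κ y

/-- The Jost solution at `+∞`. -/
def jostSolution (V : ℝ → ℂ) (κ : ℂ) (x : ℝ) : ℂ := Complex.exp (-(κ * x)) * jostAmplitude V κ x

/-- The growth of the Jost amplitude at `-∞`. -/
def jostWeight (b x : ℝ) : ℝ := Real.exp (2 * b * max (-x) 0)

/-- The integrable density that dominates the Volterra kernel. -/
def jostDensity (V : ℝ → ℂ) (b y : ℝ) : ℝ := Real.exp (2 * b * max y 0) * ‖V y‖ / (2 * b)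

/-- The tail integral of `jostDensity`. -/
def jostTail (V : ℝ → ℂ) (b x : ℝ) : ℝ := ∫ y in Set.Ioi x, jostDensity V b y

section Kernel

variable {b : ℝ} {κ : ℂ}

theorem norm_exp_neg_two_mul_le (hκ : -b < κ.re) {s : ℝ} (hs : 0 ≤ s) :
    ‖Complex.exp (-(2 * κ * s))‖ ≤ Real.exp (2 * b * s) := by
  rw [Complex.norm_exp]
  apply Real.exp_le_exp.2
  simp
  nlinarith

theorem volterraKernel_of_nonpos {t : ℝ} (ht : t ≤ 0) : volterraKernel κ t = 0 := by
  simp [volterraKernel, max_eq_right ht]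

theorem continuous_exp_neg_two_mul (κ : ℂ) :
    Continuous fun s : ℝ => Complex.exp (-(2 * κ * s)) := by fun_prop

theorem norm_volterraKernel_le (hb : 0 < b) (hκ : -b < κ.re) (t : ℝ) :
    ‖volterraKernel κ t‖ ≤ Real.exp (2 * b * max t 0) / (2 * b) := by
  have h : ‖volterraKernel κ t‖ ≤ ∫ s in (0 : ℝ)..max t 0, Real.exp (2 * b * s) := by
    refine intervalIntegral.norm_integral_le_of_norm_le (le_max_right _ _) ?_ ?_
    · exact Eventually.of_forall fun s hs => norm_exp_neg_two_mul_le hκ hs.1.le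
    · exact (Continuous.intervalIntegrable (by fun_prop) _ _)
  refine h.trans ?_
  have : ∫ s in (0 : ℝ)..max t 0, Real.exp (2 * b * s)
      = Real.exp (2 * b * max t 0) / (2 * b) - 1 / (2 * b) := by
    rw [intervalIntegral.integral_eq_sub_of_hasDerivAt
      (f := fun s => Real.exp (2 * b * s) / (2 * b)) (fun s _ => ?_)
      (Continuous.intervalIntegrable (by fun_prop) _ _)]
    · simp
    · have := (((hasDerivAt_id s).const_mul (2 * b)).exp).div_const (2 * b)
      refine this.congr_deriv ?_
      simp only [id]
      field_simp
  rw [this]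
  have : 0 < 1 / (2 * b) := by positivity
  linarith

/-- The kernel has a corner at `t = 0`, with one-sided derivatives `0` and `1`, so differentiation
under the integral sign will rest on this Lipschitz bound. -/
theorem norm_volterraKernel_sub_le (hb : 0 < b) (hκ : -b < κ.re) {t t' B : ℝ} (ht : t ≤ B)
    (ht' : t' ≤ B) :
    ‖volterraKernel κ t - volterraKernel κ t'‖ ≤ Real.exp (2 * b * max B 0) * |t - t'| := by
  have hc := continuous_exp_neg_two_mul κ
  rw [volterraKernel, volterraKernel, intervalIntegral.integral_interval_sub_left
    (hc.intervalIntegrable _ _) (hc.intervalIntegrable _ _)]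
  refine (intervalIntegral.norm_integral_le_of_norm_le_const (C := Real.exp (2 * b * max B 0))
    fun s hs => ?_).trans ?_
  · have h1 : 0 ≤ s := by
      have := hs.1
      rcases min_choice (max t' 0) (max t 0) with h | h <;> rw [h] at this
      · exact (le_max_right t' 0).trans this.le
      · exact (le_max_right t 0).trans this.le
    have h2 : s ≤ max B 0 := hs.2.trans
      (max_le (max_le_max_right 0 ht') (max_le_max_right 0 ht))
    refine (norm_exp_neg_two_mul_le hκ h1).trans (Real.exp_le_exp.2 ?_)
    gcongr
  · exact mul_le_mul_of_nonneg_left (abs_max_sub_max_le_abs t t' 0) (Real.exp_pos _).le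

theorem continuous_volterraKernel (κ : ℂ) : Continuous (volterraKernel κ) := by
  have := intervalIntegral.continuous_primitive (f := fun s : ℝ => Complex.exp (-(2 * κ * s)))
    (μ := volume) (fun a b => (continuous_exp_neg_two_mul κ).intervalIntegrable a b) 0
  exact this.comp (continuous_id.max continuous_const)

theorem hasDerivAt_volterraKernel_of_pos {t : ℝ} (ht : 0 < t) :
    HasDerivAt (volterraKernel κ) (Complex.exp (-(2 * κ * t))) t := by
  have hc := continuous_exp_neg_two_mul κ
  have := intervalIntegral.integral_hasDerivAt_right (hc.intervalIntegrable 0 t)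
    (hc.stronglyMeasurable.stronglyMeasurableAtFilter) hc.continuousAt
  refine this.congr_of_eventuallyEq ?_
  filter_upwards [lt_mem_nhds ht] with s hs
  simp [volterraKernel, max_eq_left hs.le]

theorem hasDerivAt_volterraKernel_of_neg {t : ℝ} (ht : t < 0) :
    HasDerivAt (volterraKernel κ) 0 t := by
  refine (hasDerivAt_const t (0 : ℂ)).congr_of_eventuallyEq ?_
  filter_upwards [gt_mem_nhds ht] with s hs
  exact volterraKernel_of_nonpos hs.le

theorem isOpen_setOf_lt_re (b : ℝ) : IsOpen {κ : ℂ | -b < κ.re} :=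
  isOpen_lt continuous_const Complex.continuous_re

/-- The integral form of the kernel is regular at `κ = 0`, where the quotient `(1 - e^{-2κt}) /
(2κ)` is `0 / 0`. This is why the Evans function continues across the branch point. -/
theorem differentiableOn_volterraKernel (b t : ℝ) :
    DifferentiableOn ℂ (fun κ => volterraKernel κ t) {κ : ℂ | -b < κ.re} := by
  simp only [volterraKernel, intervalIntegral.integral_of_le (le_max_right t 0)]
  refine differentiableOn_integral_of_dominated (isOpen_setOf_lt_re b)
    (bound := fun s => Real.exp (2 * b * s)) ?_ ?_ ?_ ?_
  · exact fun z _ => (continuous_exp_neg_two_mul z).aestronglyMeasurable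
  · exact Eventually.of_forall fun s => Differentiable.differentiableOn (by fun_prop)
  · filter_upwards [ae_restrict_mem measurableSet_Ioc] with s hs z hz
    exact norm_exp_neg_two_mul_le hz hs.1.le
  · exact (Continuous.integrableOn_Icc (by fun_prop)).mono_set Set.Ioc_subset_Icc_self

/-- The weight is stable under a Volterra step: the growth of the kernel splits into the weight at
`x` and the factor `e^{2b max(y, 0)}`, which `V` can absorb. -/
theorem exp_mul_jostWeight_le (hb : 0 < b) (x y : ℝ) :
    Real.exp (2 * b * (y - x)) * jostWeight b y ≤ jostWeight b x * Real.exp (2 * b * max y 0) := by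
  rw [jostWeight, jostWeight, ← Real.exp_add, ← Real.exp_add]
  apply Real.exp_le_exp.2
  rw [← mul_add, ← mul_add]
  have : y - x + max (-y) 0 ≤ max (-x) 0 + max y 0 := by
    rcases le_total y 0 with hy | hy
    · rw [max_eq_left (by linarith : 0 ≤ -y), max_eq_right hy]
      linarith [le_max_left (-x) 0]
    · rw [max_eq_right (by linarith : -y ≤ 0), max_eq_left hy]
      linarith [le_max_left (-x) 0]
  gcongr

theorem jostWeight_pos (b x : ℝ) : 0 < jostWeight b x := Real.exp_pos _

theorem jostWeight_of_nonneg {x : ℝ} (b : ℝ) (hx : 0 ≤ x) : jostWeight b x = 1 := by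
  simp [jostWeight, max_eq_right (by linarith : -x ≤ 0)]

end Kernel

/-! ### Weighted estimates for one Volterra step. -/

section Volterra

variable {V : ℝ → ℂ} {b : ℝ} {κ : ℂ}

theorem jostDensity_nonneg (V : ℝ → ℂ) (hb : 0 < b) (y : ℝ) : 0 ≤ jostDensity V b y := by
  unfold jostDensity; positivity

theorem norm_exp_mul_ofReal (r : ℝ) (z : ℂ) : ‖(Real.exp r : ℂ) * z‖ = Real.exp r * ‖z‖ := by
  rw [norm_mul, Complex.norm_real, Real.norm_of_nonneg (Real.exp_pos _).le]

theorem aestronglyMeasurable_of_exp_mul {c : ℝ → ℝ} (hc : Continuous c) {f : ℝ → ℂ}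
    (h : AEStronglyMeasurable (fun x => (Real.exp (c x) : ℂ) * f x) volume) :
    AEStronglyMeasurable f volume := by
  have h2 : Continuous fun x => (Real.exp (-c x) : ℂ) :=
    Complex.continuous_ofReal.comp (Real.continuous_exp.comp hc.neg)
  refine (h2.aestronglyMeasurable.mul h).congr (Eventually.of_forall fun x => ?_)
  simp only [Pi.mul_apply]
  rw [← mul_assoc, ← Complex.ofReal_mul, ← Real.exp_add]
  simp

theorem aestronglyMeasurable_potential
    (hV : Integrable (fun x : ℝ => (Real.exp (2 * b * |x|) : ℂ) * V x)) :
    AEStronglyMeasurable V volume :=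
  aestronglyMeasurable_of_exp_mul (c := fun x => 2 * b * |x|) (by fun_prop)
    hV.aestronglyMeasurable

theorem integrable_exp_mul_norm
    (hV : Integrable (fun x : ℝ => (Real.exp (2 * b * |x|) : ℂ) * V x)) :
    Integrable (fun x : ℝ => Real.exp (2 * b * |x|) * ‖V x‖) :=
  hV.norm.congr (Eventually.of_forall fun _ => norm_exp_mul_ofReal _ _)

theorem integrable_jostDensity (hb : 0 < b)
    (hV : Integrable (fun x : ℝ => (Real.exp (2 * b * |x|) : ℂ) * V x)) :
    Integrable (jostDensity V b) := by
  refine ((integrable_exp_mul_norm hV).div_const (2 * b)).mono' ?_ ?_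
  · have h1 : Continuous fun y => Real.exp (2 * b * max y 0) := by fun_prop
    exact ((h1.aestronglyMeasurable.mul
      (aestronglyMeasurable_potential hV).norm).mul_const (2 * b)⁻¹).congr
      (Eventually.of_forall fun y => by simp [jostDensity, div_eq_mul_inv])
  · refine Eventually.of_forall fun y => ?_
    rw [Real.norm_of_nonneg (jostDensity_nonneg V hb y), jostDensity]
    gcongr
    exact max_le (le_abs_self y) (abs_nonneg y)

theorem isPrimitive_jostTail (hb : 0 < b)
    (hV : Integrable (fun x : ℝ => (Real.exp (2 * b * |x|) : ℂ) * V x)) :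
    IsPrimitive (jostTail V b) (fun x => - jostDensity V b x) :=
  isPrimitive_integral_Ioi fun _ => (integrable_jostDensity hb hV).integrableOn

theorem jostTail_nonneg (hb : 0 < b) (x : ℝ) : 0 ≤ jostTail V b x :=
  integral_nonneg fun y => jostDensity_nonneg V hb y

theorem jostTail_le (hb : 0 < b)
    (hV : Integrable (fun x : ℝ => (Real.exp (2 * b * |x|) : ℂ) * V x)) (x : ℝ) :
    jostTail V b x ≤ ∫ y, jostDensity V b y :=
  setIntegral_le_integral (integrable_jostDensity hb hV)
    (Eventually.of_forall fun y => jostDensity_nonneg V hb y)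

theorem tendsto_jostTail (hb : 0 < b)
    (hV : Integrable (fun x : ℝ => (Real.exp (2 * b * |x|) : ℂ) * V x)) :
    Tendsto (jostTail V b) atTop (𝓝 0) :=
  tendsto_integral_Ioi (c := 0) (integrable_jostDensity hb hV).integrableOn

theorem integrable_jostDensity_mul_pow (hb : 0 < b)
    (hV : Integrable (fun x : ℝ => (Real.exp (2 * b * |x|) : ℂ) * V x)) (n : ℕ) :
    Integrable (fun y => jostDensity V b y * jostTail V b y ^ n) := by
  refine (integrable_jostDensity hb hV).mul_bdd (c := (∫ y, jostDensity V b y) ^ n) ?_ ?_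
  · exact ((isPrimitive_jostTail hb hV).continuous.pow n).aestronglyMeasurable
  · refine Eventually.of_forall fun y => ?_
    rw [Real.norm_of_nonneg (pow_nonneg (jostTail_nonneg hb y) n)]
    exact pow_le_pow_left₀ (jostTail_nonneg hb y) (jostTail_le hb hV y) n

/-- With `T` the tail, the integrand is the derivative of `-T ^ (n + 1) / (n + 1)`, and `T` tends to
zero. The factorials in the Neumann bound come from here. -/
theorem integral_Ioi_jostDensity_mul_pow (hb : 0 < b)
    (hV : Integrable (fun x : ℝ => (Real.exp (2 * b * |x|) : ℂ) * V x)) (n : ℕ) (x : ℝ) :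
    ∫ y in Set.Ioi x, jostDensity V b y * jostTail V b y ^ n
      = jostTail V b x ^ (n + 1) / (n + 1) := by
  have hp := (isPrimitive_jostTail hb hV).pow n
  have h1 := intervalIntegral_tendsto_integral_Ioi x
    (integrable_jostDensity_mul_pow hb hV n).integrableOn tendsto_id
  refine tendsto_nhds_unique h1 ?_
  have h2 : ∀ y, ∫ t in x..y, jostDensity V b t * jostTail V b t ^ n
      = (jostTail V b x ^ (n + 1) - jostTail V b y ^ (n + 1)) / (n + 1) := by
    intro y
    have hn : (n + 1 : ℝ) ≠ 0 := by positivity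
    have := hp.sub_eq x y
    rw [eq_div_iff hn, ← neg_sub (jostTail V b y ^ (n + 1)), this, mul_comm,
      ← intervalIntegral.integral_const_mul, ← intervalIntegral.integral_neg]
    congr 1; ext t; ring
  simp only [id, h2]
  have h3 := ((tendsto_jostTail hb hV).pow (n + 1)).const_sub (jostTail V b x ^ (n + 1))
  simpa using h3.div_const (n + 1 : ℝ)

/-- Since `y` is fixed, `C` may depend on it; both the tail power at `y` and the constant total-mass
bound are inserted later. -/
theorem norm_volterraKernel_mul_le (hb : 0 < b) (hκ : -b < κ.re) (x y : ℝ) {z : ℂ} {C : ℝ}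
    (hC : 0 ≤ C) (hz : ‖z‖ ≤ jostWeight b y * C) :
    ‖volterraKernel κ (y - x) * V y * z‖ ≤
      (Set.Ioi x).indicator (fun y => jostWeight b x * (jostDensity V b y * C)) y := by
  by_cases h : x < y
  · rw [Set.indicator_of_mem (Set.mem_Ioi.2 h), norm_mul, norm_mul]
    have h1 := norm_volterraKernel_le hb hκ (y - x)
    rw [max_eq_left (by linarith)] at h1
    have h2 := exp_mul_jostWeight_le hb x y
    calc ‖volterraKernel κ (y - x)‖ * ‖V y‖ * ‖z‖
        ≤ (Real.exp (2 * b * (y - x)) / (2 * b)) * ‖V y‖ * (jostWeight b y * C) := by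
          gcongr
      _ = (Real.exp (2 * b * (y - x)) * jostWeight b y) * (‖V y‖ / (2 * b) * C) := by ring
      _ ≤ (jostWeight b x * Real.exp (2 * b * max y 0)) * (‖V y‖ / (2 * b) * C) := by gcongr
      _ = _ := by rw [jostDensity]; ring
  · rw [volterraKernel_of_nonpos (by linarith)]
    simp [h]

theorem norm_exp_mul_potential_mul_le (hb : 0 < b) (hκ : -b < κ.re) {x y : ℝ} (h : x ≤ y) {z : ℂ}
    {C : ℝ} (hC : 0 ≤ C) (hz : ‖z‖ ≤ jostWeight b y * C) :
    ‖Complex.exp (-(2 * κ * (y - x))) * V y * z‖ ≤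
      jostWeight b x * (2 * b * C) * jostDensity V b y := by
  rw [norm_mul, norm_mul]
  have h1 := norm_exp_neg_two_mul_le hκ (sub_nonneg.2 h)
  push_cast at h1
  have h2 := exp_mul_jostWeight_le hb x y
  calc ‖Complex.exp (-(2 * κ * (y - x)))‖ * ‖V y‖ * ‖z‖
      ≤ Real.exp (2 * b * (y - x)) * ‖V y‖ * (jostWeight b y * C) := by gcongr
    _ = (Real.exp (2 * b * (y - x)) * jostWeight b y) * (‖V y‖ * C) := by ring
    _ ≤ (jostWeight b x * Real.exp (2 * b * max y 0)) * (‖V y‖ * C) := by gcongr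
    _ = _ := by rw [jostDensity]; field_simp

theorem hasDerivAt_integral_volterraKernel (hb : 0 < b) (hκ : -b < κ.re)
    (hV : Integrable (fun x : ℝ => (Real.exp (2 * b * |x|) : ℂ) * V x)) {h : ℝ → ℂ}
    (hm : AEStronglyMeasurable h volume) {C : ℝ} (hC : 0 ≤ C)
    (hh : ∀ y, ‖h y‖ ≤ jostWeight b y * C) (x : ℝ) :
    HasDerivAt (fun x => ∫ y, volterraKernel κ (y - x) * V y * h y)
      (-∫ y in Set.Ioi x, Complex.exp (-(2 * κ * (y - x))) * V y * h y) x := by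
  have hVm := aestronglyMeasurable_potential hV
  have hmeas : ∀ x, AEStronglyMeasurable (fun y => volterraKernel κ (y - x) * V y * h y) volume :=
    fun x => ((((continuous_volterraKernel κ).comp
      (continuous_id.sub continuous_const)).aestronglyMeasurable).mul hVm).mul hm
  -- The corner of the kernel lies over the single point `y = x`.
  have hne : ∀ᵐ y : ℝ, y ≠ x := by
    simp [ae_iff]
  have key := hasDerivAt_integral_of_dominated_loc_of_lip (μ := volume) (x₀ := x)
    (s := Metric.ball x 1) (F := fun x y => volterraKernel κ (y - x) * V y * h y)
    (F' := (Set.Ioi x).indicator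
      (fun y => -(Complex.exp (-(2 * κ * (y - x))) * V y * h y)))
    (bound := fun y => Real.exp (2 * b * |1 - x|) * C * (Real.exp (2 * b * |y|) * ‖V y‖))
    (Metric.ball_mem_nhds x one_pos) (Eventually.of_forall hmeas) ?_ ?_ ?_ ?_ ?_
  · have := key.2
    rwa [integral_indicator measurableSet_Ioi, integral_neg] at this
  · refine Integrable.mono' (((((integrable_jostDensity hb hV).mul_const C).const_mul
      (jostWeight b x))).indicator (measurableSet_Ioi (a := x))) (hmeas x)
      (Eventually.of_forall fun y => ?_)
    exact norm_volterraKernel_mul_le hb hκ x y hC (hh y)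
  · refine AEStronglyMeasurable.indicator ?_ measurableSet_Ioi
    have h1 : Continuous fun y : ℝ => Complex.exp (-(2 * κ * (y - x))) := by fun_prop
    exact ((h1.aestronglyMeasurable.mul hVm).mul hm).neg
  · refine Eventually.of_forall fun y => LipschitzOnWith.of_dist_le_mul fun s hs t ht => ?_
    rw [dist_eq_norm, ← sub_mul, ← sub_mul, norm_mul, norm_mul, Real.coe_nnabs, abs_of_nonneg
      (by positivity)]
    rw [Metric.mem_ball, Real.dist_eq, abs_lt] at hs ht
    -- For `s` in the unit ball about `x`, `y - s < y + (1 - x)`; the shift costs the factor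
    -- `e^{2b|1 - x|}`, constant in `y`.
    have h1 := norm_volterraKernel_sub_le hb hκ (t := y - s) (t' := y - t) (B := y + (1 - x))
      (by linarith) (by linarith)
    have h2 : |y - s - (y - t)| = dist s t := by
      rw [Real.dist_eq, abs_sub_comm]; congr 1; ring
    rw [h2] at h1
    have h3 : Real.exp (2 * b * max (y + (1 - x)) 0) * jostWeight b y
        ≤ Real.exp (2 * b * |1 - x|) * Real.exp (2 * b * |y|) := by
      rw [jostWeight, ← Real.exp_add, ← Real.exp_add, ← mul_add, ← mul_add]
      have : max (y + (1 - x)) 0 + max (-y) 0 ≤ |1 - x| + |y| := by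
        have e1 := le_abs_self (1 - x)
        have e2 := abs_nonneg (1 - x)
        rcases le_total y 0 with h | h
        · rw [max_eq_left (by linarith : 0 ≤ -y), abs_of_nonpos h]
          have : max (y + (1 - x)) 0 ≤ |1 - x| := max_le (by linarith) e2
          linarith
        · rw [max_eq_right (by linarith : -y ≤ 0), abs_of_nonneg h]
          have : max (y + (1 - x)) 0 ≤ |1 - x| + y := max_le (by linarith) (by linarith)
          linarith
      gcongr
    calc ‖volterraKernel κ (y - s) - volterraKernel κ (y - t)‖ * ‖V y‖ * ‖h y‖
        ≤ (Real.exp (2 * b * max (y + (1 - x)) 0) * dist s t) * ‖V y‖ * (jostWeight b y * C) := by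
          gcongr
          exact hh y
      _ = (Real.exp (2 * b * max (y + (1 - x)) 0) * jostWeight b y) * (dist s t * ‖V y‖ * C) := by
          ring
      _ ≤ (Real.exp (2 * b * |1 - x|) * Real.exp (2 * b * |y|)) * (dist s t * ‖V y‖ * C) := by
          gcongr
      _ = _ := by ring
  · exact (integrable_exp_mul_norm hV).const_mul _
  · filter_upwards [hne] with y hy
    have hsub : HasDerivAt (fun x : ℝ => y - x) (-1) x := (hasDerivAt_id x).const_sub y
    rcases lt_or_gt_of_ne hy with h1 | h1
    · rw [Set.indicator_of_notMem (by simpa using h1.le)]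
      have := ((hasDerivAt_volterraKernel_of_neg (κ := κ) (t := y - x) (by linarith)).scomp x
        hsub).mul_const (V y * h y)
      simpa [mul_assoc, Function.comp_def] using this
    · rw [Set.indicator_of_mem (Set.mem_Ioi.2 h1)]
      have := ((hasDerivAt_volterraKernel_of_pos (κ := κ) (t := y - x) (by linarith)).scomp x
        hsub).mul_const (V y * h y)
      simpa [mul_assoc, Function.comp_def] using this

end Volterra

/-! ### The Neumann series: Volterra equation, asymptotics, holomorphy in `κ`. -/

section Series

variable {V : ℝ → ℂ} {b : ℝ} {κ : ℂ}

theorem norm_jostTerm_le (hb : 0 < b) (hκ : -b < κ.re)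
    (hV : Integrable (fun x : ℝ => (Real.exp (2 * b * |x|) : ℂ) * V x)) (n : ℕ) (x : ℝ) :
    ‖jostTerm V κ n x‖ ≤ jostWeight b x * (jostTail V b x ^ n / n.factorial) := by
  induction n generalizing x with
  | zero =>
    simp only [jostTerm, norm_one, pow_zero, Nat.factorial_zero, Nat.cast_one, div_one, mul_one]
    unfold jostWeight
    exact Real.one_le_exp (by positivity)
  | succ n ih =>
    have hint : Integrable (fun y => jostWeight b x * (jostDensity V b y *
        (jostTail V b y ^ n / n.factorial))) := by
      refine (((integrable_jostDensity_mul_pow hb hV n).div_const n.factorial).const_mul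
        (jostWeight b x)).congr (Eventually.of_forall fun y => ?_)
      ring
    rw [jostTerm]
    calc ‖∫ y, volterraKernel κ (y - x) * V y * jostTerm V κ n y‖
        ≤ ∫ y, (Set.Ioi x).indicator (fun y => jostWeight b x * (jostDensity V b y *
            (jostTail V b y ^ n / n.factorial))) y := by
          refine norm_integral_le_of_norm_le (hint.indicator measurableSet_Ioi)
            (Eventually.of_forall fun y => ?_)
          have := norm_volterraKernel_mul_le (V := V) hb hκ x y (z := jostTerm V κ n y)
            (C := jostTail V b y ^ n / n.factorial)
            (div_nonneg (pow_nonneg (jostTail_nonneg hb y) n) (by positivity)) (ih y)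
          by_cases h : x < y
          · rw [Set.indicator_of_mem (Set.mem_Ioi.2 h)] at this ⊢
            exact this
          · rw [Set.indicator_of_notMem (by simpa using h)] at this ⊢
            exact this
      _ = jostWeight b x / n.factorial *
            ∫ y in Set.Ioi x, jostDensity V b y * jostTail V b y ^ n := by
          rw [integral_indicator measurableSet_Ioi, ← integral_const_mul]
          congr 1; ext y; ring
      _ = _ := by
          rw [integral_Ioi_jostDensity_mul_pow hb hV, Nat.factorial_succ]
          push_cast
          field_simp

/-- The total mass of the dominating density. -/
def jostMass (V : ℝ → ℂ) (b : ℝ) : ℝ := ∫ y, jostDensity V b y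

theorem jostMass_nonneg (V : ℝ → ℂ) (hb : 0 < b) : 0 ≤ jostMass V b :=
  integral_nonneg fun y => jostDensity_nonneg V hb y

/-- Coarser than the tail bound, but the factor beside the weight no longer depends on `x`, as
`hasDerivAt_integral_volterraKernel` requires. It is also uniform in `κ`, which makes the series
holomorphic. -/
theorem norm_jostTerm_le_mass (hb : 0 < b) (hκ : -b < κ.re)
    (hV : Integrable (fun x : ℝ => (Real.exp (2 * b * |x|) : ℂ) * V x)) (n : ℕ) (x : ℝ) :
    ‖jostTerm V κ n x‖ ≤ jostWeight b x * (jostMass V b ^ n / n.factorial) := by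
  refine (norm_jostTerm_le hb hκ hV n x).trans ?_
  have := jostTail_nonneg (V := V) hb x
  have := jostTail_le hb hV x
  have := jostWeight_pos b x
  unfold jostMass
  gcongr

theorem hasSum_pow_div_factorial (M : ℝ) :
    HasSum (fun n : ℕ => M ^ n / n.factorial) (Real.exp M) := by
  rw [Real.exp_eq_exp_ℝ]
  simpa [div_eq_inv_mul] using NormedSpace.exp_series_hasSum_exp' (𝕂 := ℝ) M

theorem hasSum_jostTerm (hb : 0 < b) (hκ : -b < κ.re)
    (hV : Integrable (fun x : ℝ => (Real.exp (2 * b * |x|) : ℂ) * V x)) (x : ℝ) :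
    HasSum (fun n => jostTerm V κ n x) (jostAmplitude V κ x) :=
  (Summable.of_norm_bounded ((hasSum_pow_div_factorial (jostMass V b)).summable.mul_left _)
    (fun n => norm_jostTerm_le_mass hb hκ hV n x)).hasSum

theorem norm_jostAmplitude_le (hb : 0 < b) (hκ : -b < κ.re)
    (hV : Integrable (fun x : ℝ => (Real.exp (2 * b * |x|) : ℂ) * V x)) (x : ℝ) :
    ‖jostAmplitude V κ x‖ ≤ jostWeight b x * Real.exp (jostMass V b) :=
  tsum_of_norm_bounded ((hasSum_pow_div_factorial (jostMass V b)).mul_left _)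
    (fun n => norm_jostTerm_le_mass hb hκ hV n x)

theorem continuous_jostTerm (hb : 0 < b) (hκ : -b < κ.re)
    (hV : Integrable (fun x : ℝ => (Real.exp (2 * b * |x|) : ℂ) * V x)) (n : ℕ) :
    Continuous (jostTerm V κ n) := by
  induction n with
  | zero => exact continuous_const
  | succ n ih =>
    refine continuous_iff_continuousAt.2 fun x => ?_
    exact (hasDerivAt_integral_volterraKernel hb hκ hV ih.aestronglyMeasurable
      (div_nonneg (pow_nonneg (jostMass_nonneg V hb) n) (by positivity))
      (norm_jostTerm_le_mass hb hκ hV n) x).continuousAt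

theorem aestronglyMeasurable_jostAmplitude (hb : 0 < b) (hκ : -b < κ.re)
    (hV : Integrable (fun x : ℝ => (Real.exp (2 * b * |x|) : ℂ) * V x)) :
    AEStronglyMeasurable (jostAmplitude V κ) volume := by
  refine aestronglyMeasurable_of_tendsto_ae atTop
    (f := fun N x => ∑ n ∈ Finset.range N, jostTerm V κ n x) (fun N => ?_)
    (Eventually.of_forall fun x => (hasSum_jostTerm hb hκ hV x).tendsto_sum_nat)
  exact (continuous_finsetSum _ fun n _ => continuous_jostTerm hb hκ hV n).aestronglyMeasurable

theorem aestronglyMeasurable_volterraKernel_mul {h : ℝ → ℂ}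
    (hV : Integrable (fun x : ℝ => (Real.exp (2 * b * |x|) : ℂ) * V x))
    (hm : AEStronglyMeasurable h volume) (κ : ℂ) (x : ℝ) :
    AEStronglyMeasurable (fun y => volterraKernel κ (y - x) * V y * h y) volume :=
  (((continuous_volterraKernel κ).comp (continuous_id.sub continuous_const)).aestronglyMeasurable.mul
    (aestronglyMeasurable_potential hV)).mul hm

/-- The Volterra equation for the Jost amplitude. -/
theorem jostAmplitude_eq (hb : 0 < b) (hκ : -b < κ.re)
    (hV : Integrable (fun x : ℝ => (Real.exp (2 * b * |x|) : ℂ) * V x)) (x : ℝ) :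
    jostAmplitude V κ x = 1 + ∫ y, volterraKernel κ (y - x) * V y * jostAmplitude V κ y := by
  have h := hasSum_jostTerm hb hκ hV x
  have h1 : HasSum (fun n => jostTerm V κ (n + 1) x)
      (∫ y, volterraKernel κ (y - x) * V y * jostAmplitude V κ y) := by
    refine hasSum_integral_of_dominated_convergence
      (bound := fun n y => jostWeight b x * jostDensity V b y *
        (jostMass V b ^ n / n.factorial)) (fun n => ?_) (fun n => ?_) ?_ ?_ ?_
    · exact aestronglyMeasurable_volterraKernel_mul hV
        (continuous_jostTerm hb hκ hV n).aestronglyMeasurable κ x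
    · refine Eventually.of_forall fun y => ?_
      have hC : 0 ≤ jostMass V b ^ n / n.factorial :=
        div_nonneg (pow_nonneg (jostMass_nonneg V hb) n) (by positivity)
      refine (norm_volterraKernel_mul_le (V := V) hb hκ x y hC
        (norm_jostTerm_le_mass hb hκ hV n y)).trans ?_
      rw [mul_assoc]
      refine Set.indicator_le_self' (fun y _ => ?_) y
      exact mul_nonneg (jostWeight_pos b x).le (mul_nonneg (jostDensity_nonneg V hb y) hC)
    · exact Eventually.of_forall fun y => (hasSum_pow_div_factorial _).summable.mul_left _
    · simp_rw [tsum_mul_left]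
      exact ((integrable_jostDensity hb hV).const_mul _).mul_const _
    · exact Eventually.of_forall fun y => (hasSum_jostTerm hb hκ hV y).mul_left _
  rw [h.tsum_eq.symm, h.summable.tsum_eq_zero_add, h1.tsum_eq, jostTerm]

theorem hasDerivAt_jostAmplitude (hb : 0 < b) (hκ : -b < κ.re)
    (hV : Integrable (fun x : ℝ => (Real.exp (2 * b * |x|) : ℂ) * V x)) (x : ℝ) :
    HasDerivAt (jostAmplitude V κ) (jostSlope V κ x) x := by
  have h := (hasDerivAt_integral_volterraKernel hb hκ hV
    (aestronglyMeasurable_jostAmplitude hb hκ hV) (Real.exp_pos _).le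
    (norm_jostAmplitude_le hb hκ hV) x).const_add 1
  exact h.congr_of_eventuallyEq (Eventually.of_forall fun y => jostAmplitude_eq hb hκ hV y)

theorem norm_jostAmplitude_sub_one_le (hb : 0 < b) (hκ : -b < κ.re)
    (hV : Integrable (fun x : ℝ => (Real.exp (2 * b * |x|) : ℂ) * V x)) {x : ℝ} (hx : 0 ≤ x) :
    ‖jostAmplitude V κ x - 1‖ ≤ jostTail V b x * Real.exp (jostMass V b) := by
  rw [jostAmplitude_eq hb hκ hV x, add_sub_cancel_left]
  have hint := (((integrable_jostDensity hb hV).mul_const (Real.exp (jostMass V b))).const_mul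
    (jostWeight b x)).indicator (measurableSet_Ioi (a := x))
  refine (norm_integral_le_of_norm_le hint (Eventually.of_forall fun y =>
    norm_volterraKernel_mul_le hb hκ x y (Real.exp_pos _).le
      (norm_jostAmplitude_le hb hκ hV y))).trans_eq ?_
  rw [integral_indicator measurableSet_Ioi, jostWeight_of_nonneg b hx]
  simp only [one_mul]
  rw [integral_mul_const, jostTail]

theorem norm_jostSlope_le (hb : 0 < b) (hκ : -b < κ.re)
    (hV : Integrable (fun x : ℝ => (Real.exp (2 * b * |x|) : ℂ) * V x)) {x : ℝ} (hx : 0 ≤ x) :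
    ‖jostSlope V κ x‖ ≤ 2 * b * Real.exp (jostMass V b) * jostTail V b x := by
  rw [jostSlope, norm_neg, jostTail, ← integral_const_mul]
  refine norm_integral_le_of_norm_le ((integrable_jostDensity hb hV).const_mul _).integrableOn ?_
  filter_upwards [ae_restrict_mem measurableSet_Ioi] with y hy
  have := norm_exp_mul_potential_mul_le (V := V) hb hκ (le_of_lt hy) (Real.exp_pos _).le
    (norm_jostAmplitude_le hb hκ hV y)
  rwa [jostWeight_of_nonneg b hx, one_mul] at this

theorem tendsto_jostAmplitude (hb : 0 < b) (hκ : -b < κ.re)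
    (hV : Integrable (fun x : ℝ => (Real.exp (2 * b * |x|) : ℂ) * V x)) :
    Tendsto (jostAmplitude V κ) atTop (𝓝 1) := by
  rw [tendsto_iff_norm_sub_tendsto_zero]
  have h := (tendsto_jostTail hb hV).mul_const (Real.exp (jostMass V b))
  rw [zero_mul] at h
  refine squeeze_zero' (Eventually.of_forall fun _ => norm_nonneg _) ?_ h
  filter_upwards [eventually_ge_atTop 0] with x hx using norm_jostAmplitude_sub_one_le hb hκ hV hx

theorem tendsto_jostSlope (hb : 0 < b) (hκ : -b < κ.re)
    (hV : Integrable (fun x : ℝ => (Real.exp (2 * b * |x|) : ℂ) * V x)) :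
    Tendsto (jostSlope V κ) atTop (𝓝 0) := by
  have h := (tendsto_jostTail hb hV).const_mul (2 * b * Real.exp (jostMass V b))
  rw [mul_zero] at h
  refine squeeze_zero_norm' ?_ h
  filter_upwards [eventually_ge_atTop 0] with x hx using norm_jostSlope_le hb hκ hV hx

theorem differentiableOn_jostTerm (hb : 0 < b)
    (hV : Integrable (fun x : ℝ => (Real.exp (2 * b * |x|) : ℂ) * V x)) (n : ℕ) (x : ℝ) :
    DifferentiableOn ℂ (fun κ => jostTerm V κ n x) {κ : ℂ | -b < κ.re} := by
  induction n generalizing x with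
  | zero => exact differentiableOn_const _
  | succ n ih =>
    have hC : 0 ≤ jostMass V b ^ n / n.factorial :=
      div_nonneg (pow_nonneg (jostMass_nonneg V hb) n) (by positivity)
    refine differentiableOn_integral_of_dominated (isOpen_setOf_lt_re b)
      (bound := (Set.Ioi x).indicator fun y => jostWeight b x * (jostDensity V b y *
        (jostMass V b ^ n / n.factorial))) (fun κ hκ => ?_) ?_ ?_ ?_
    · exact aestronglyMeasurable_volterraKernel_mul hV
        (continuous_jostTerm hb hκ hV n).aestronglyMeasurable κ x
    · exact Eventually.of_forall fun y =>
        ((differentiableOn_volterraKernel b (y - x)).mul_const (V y)).mul (ih y)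
    · exact Eventually.of_forall fun y κ hκ =>
        norm_volterraKernel_mul_le hb hκ x y hC (norm_jostTerm_le_mass hb hκ hV n y)
    · exact (((integrable_jostDensity hb hV).mul_const _).const_mul _).indicator measurableSet_Ioi

theorem differentiableOn_jostAmplitude (hb : 0 < b)
    (hV : Integrable (fun x : ℝ => (Real.exp (2 * b * |x|) : ℂ) * V x)) (x : ℝ) :
    DifferentiableOn ℂ (fun κ => jostAmplitude V κ x) {κ : ℂ | -b < κ.re} :=
  Complex.differentiableOn_tsum_of_summable_norm
    ((hasSum_pow_div_factorial (jostMass V b)).summable.mul_left (jostWeight b x))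
    (fun n => differentiableOn_jostTerm hb hV n x) (isOpen_setOf_lt_re b)
    (fun n _ hκ => norm_jostTerm_le_mass hb hκ hV n x)

theorem differentiableOn_jostSlope (hb : 0 < b)
    (hV : Integrable (fun x : ℝ => (Real.exp (2 * b * |x|) : ℂ) * V x)) (x : ℝ) :
    DifferentiableOn ℂ (fun κ => jostSlope V κ x) {κ : ℂ | -b < κ.re} := by
  refine DifferentiableOn.neg ?_
  refine differentiableOn_integral_of_dominated (isOpen_setOf_lt_re b)
    (bound := fun y => jostWeight b x * (2 * b * Real.exp (jostMass V b)) * jostDensity V b y)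
    (fun κ hκ => ?_) ?_ ?_ ?_
  · have h1 : Continuous fun y : ℝ => Complex.exp (-(2 * κ * (y - x))) := by fun_prop
    exact ((h1.aestronglyMeasurable.mul (aestronglyMeasurable_potential hV)).mul
      (aestronglyMeasurable_jostAmplitude hb hκ hV)).restrict
  · refine Eventually.of_forall fun y => ?_
    have h1 : Differentiable ℂ fun κ : ℂ => Complex.exp (-(2 * κ * (y - x))) := by fun_prop
    exact (h1.differentiableOn.mul_const (V y)).mul (differentiableOn_jostAmplitude hb hV y)
  · filter_upwards [ae_restrict_mem measurableSet_Ioi] with y hy κ hκ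
    exact norm_exp_mul_potential_mul_le hb hκ (le_of_lt hy) (Real.exp_pos _).le
      (norm_jostAmplitude_le hb hκ hV y)
  · exact ((integrable_jostDensity hb hV).const_mul _).integrableOn

theorem hasDerivAt_jostSolution (hb : 0 < b) (hκ : -b < κ.re)
    (hV : Integrable (fun x : ℝ => (Real.exp (2 * b * |x|) : ℂ) * V x)) (x : ℝ) :
    HasDerivAt (jostSolution V κ)
      (Complex.exp (-(κ * x)) * (jostSlope V κ x - κ * jostAmplitude V κ x)) x := by
  have h1 : HasDerivAt (fun x : ℝ => Complex.exp (-(κ * x))) (Complex.exp (-(κ * x)) * (-κ)) x := by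
    have := (((hasDerivAt_id x).ofReal_comp.const_mul κ).neg).cexp
    simpa using this
  exact (h1.mul (hasDerivAt_jostAmplitude hb hκ hV x)).congr_deriv (by ring)

end Series

/-! ### Jost solutions and their characterisation on both sheets. -/

/-- `u` satisfies the integrated first-order equation `u' + κ u = -∫_x^∞ e^{-κ(y-x)} V u`, which
singles out the multiples of the Jost solution at `+∞`. -/
structure IsRightJost (V : ℝ → ℂ) (κ : ℂ) (b : ℝ) (u : ℝ → ℂ) : Prop where
  differentiable : Differentiable ℝ u
  tail : ∀ x, deriv u x + κ * u x
    = -∫ y in Set.Ioi x, Complex.exp (-(κ * (y - x))) * (V y * u y)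
  bound : ∃ C : ℝ, ∀ x, 0 ≤ x → ‖u x‖ ≤ C * Real.exp (b * x)
  integrable : ∀ c : ℝ, IntegrableOn (fun y => (Real.exp (b * y) : ℂ) * (V y * u y)) (Set.Ioi c)

section JostSolutions

variable {V : ℝ → ℂ} {b : ℝ} {κ k : ℂ} {u v : ℝ → ℂ}

theorem integrableOn_exp_neg_mul {f : ℝ → ℂ} (hκ : -b < κ.re) {c : ℝ}
    (hf : IntegrableOn (fun y => (Real.exp (b * y) : ℂ) * f y) (Set.Ioi c)) :
    IntegrableOn (fun y : ℝ => Complex.exp (-(κ * y)) * f y) (Set.Ioi c) := by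
  have hc : Continuous fun y : ℝ => Complex.exp (-((κ + b) * y)) := by fun_prop
  have h : IntegrableOn (fun y : ℝ => Complex.exp (-((κ + b) * y)) *
      ((Real.exp (b * y) : ℂ) * f y)) (Set.Ioi c) := by
    -- Since `κ.re + b > 0`, the factor `e^{-(κ + b)y}` has its largest modulus on `(c, ∞)` at the
    -- endpoint.
    refine Integrable.bdd_mul (c := Real.exp (-((κ.re + b) * c))) hf hc.aestronglyMeasurable ?_
    filter_upwards [ae_restrict_mem measurableSet_Ioi] with y hy
    rw [Complex.norm_exp]
    apply Real.exp_le_exp.2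
    have : c < y := hy
    simp
    nlinarith
  refine h.congr (Eventually.of_forall fun y => ?_)
  simp only
  rw [← mul_assoc, Complex.ofReal_exp, ← Complex.exp_add]
  congr 2
  push_cast; ring

theorem IsRightJost.tail_eq (hu : IsRightJost V κ b u) (x : ℝ) :
    deriv u x + κ * u x
      = -(Complex.exp (κ * x) * ∫ y in Set.Ioi x, Complex.exp (-(κ * y)) * (V y * u y)) := by
  rw [hu.tail, ← integral_const_mul]
  congr 2
  ext y
  rw [← mul_assoc (Complex.exp (κ * x)), ← Complex.exp_add]
  congr 2
  ring

theorem isPrimitive_exp_mul (κ : ℂ) :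
    IsPrimitive (fun x : ℝ => Complex.exp (κ * x)) (fun x => κ * Complex.exp (κ * x)) := by
  refine isPrimitive_of_hasDerivAt (fun x => ?_) (by fun_prop)
  have := ((hasDerivAt_id x).ofReal_comp.const_mul κ).cexp
  simpa [mul_comm] using this

/-- Write `u' = -κu - e^{κx} Q` with `Q' = -e^{-κx} V u`. Differentiating once more and eliminating
`Q` leaves `u'' = (V + κ ^ 2) u`. -/
theorem IsRightJost.isSolution (hκ : -b < κ.re) (hk : k ^ 2 = -κ ^ 2)
    (hu : IsRightJost V κ b u) : IsSolution V k u := by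
  set Q : ℝ → ℂ := fun x => ∫ y in Set.Ioi x, Complex.exp (-(κ * y)) * (V y * u y) with hQ
  have hQp : IsPrimitive Q (fun x => -(Complex.exp (-(κ * x)) * (V x * u x))) :=
    isPrimitive_integral_Ioi fun c => integrableOn_exp_neg_mul hκ (hu.integrable c)
  have hd : deriv u = fun x => -κ * u x - Complex.exp (κ * x) * Q x := by
    ext x
    linear_combination hu.tail_eq x
  have h1 : IsPrimitive u (fun x => -κ * u x - Complex.exp (κ * x) * Q x) := by
    refine isPrimitive_of_hasDerivAt (fun x => ?_) ?_
    · have := (hu.differentiable x).hasDerivAt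
      rwa [hd] at this
    · have := hu.differentiable.continuous
      have := hQp.continuous
      fun_prop
  refine .of_isPrimitive h1 (((h1.const_mul (-κ)).sub ((isPrimitive_exp_mul κ).mul hQp)).congr'
    (fun _ => rfl) fun x => ?_)
  have he : Complex.exp (κ * x) * Complex.exp (-(κ * x)) = 1 := by
    rw [← Complex.exp_add]; simp
  rw [hk]
  linear_combination V x * u x * he

theorem IsRightJost.norm_tail_le (hκ : -b < κ.re) (hu : IsRightJost V κ b u) (x : ℝ) :
    ‖deriv u x + κ * u x‖ ≤
      Real.exp (-(b * x)) * ∫ y in Set.Ioi x, ‖(Real.exp (b * y) : ℂ) * (V y * u y)‖ := by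
  rw [hu.tail, norm_neg, ← integral_const_mul]
  refine norm_integral_le_of_norm_le ((hu.integrable x).norm.const_mul _) ?_
  filter_upwards [ae_restrict_mem measurableSet_Ioi] with y hy
  have hy' : x < y := hy
  rw [norm_mul, norm_exp_mul_ofReal, ← mul_assoc, ← Real.exp_add, Complex.norm_exp]
  refine mul_le_mul_of_nonneg_right (Real.exp_le_exp.2 ?_) (norm_nonneg _)
  simp
  nlinarith

theorem IsRightJost.tendsto_bound (hu : IsRightJost V κ b u) :
    Tendsto (fun x => ∫ y in Set.Ioi x, ‖(Real.exp (b * y) : ℂ) * (V y * u y)‖) atTop (𝓝 0) :=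
  tendsto_integral_Ioi (hu.integrable 0).norm

/-- The Wronskian equals `u (v' + κv) - (u' + κu) v`. Here `u` and `v` are `O(e^{bx})` while the
brackets are `o(e^{-bx})`, so the constant Wronskian tends to zero. No sign of `Re κ` enters. -/
theorem IsRightJost.wronskian_eq_zero (hV : LocallyIntegrable V volume)
    (hκ : -b < κ.re) (hu : IsRightJost V κ b u) (hv : IsRightJost V κ b v) (x : ℝ) :
    wronskian u v x = 0 := by
  have hk : (Complex.I * κ) ^ 2 = -κ ^ 2 := by rw [mul_pow, Complex.I_sq]; ring
  have hconst := wronskian_eq hV (hu.isSolution hκ hk) (hv.isSolution hκ hk)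
  obtain ⟨C, hC⟩ := hu.bound
  obtain ⟨D, hD⟩ := hv.bound
  have hlim : Tendsto (wronskian u v) atTop (𝓝 0) := by
    have h := (hv.tendsto_bound.const_mul C).add (hu.tendsto_bound.const_mul D)
    rw [mul_zero, mul_zero, add_zero] at h
    refine squeeze_zero_norm' ?_ h
    filter_upwards [eventually_ge_atTop 0] with x hx
    have e : wronskian u v x
        = u x * (deriv v x + κ * v x) - (deriv u x + κ * u x) * v x := by
      rw [wronskian]; ring
    have he : Real.exp (b * x) * Real.exp (-(b * x)) = 1 := by rw [← Real.exp_add]; simp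
    have h1 := hu.norm_tail_le hκ x
    have h2 := hv.norm_tail_le hκ x
    have h3 := hC x hx
    have h4 := hD x hx
    set P := ∫ y in Set.Ioi x, ‖(Real.exp (b * y) : ℂ) * (V y * u y)‖
    set R := ∫ y in Set.Ioi x, ‖(Real.exp (b * y) : ℂ) * (V y * v y)‖
    rw [e]
    calc _ ≤ ‖u x‖ * ‖deriv v x + κ * v x‖ + ‖deriv u x + κ * u x‖ * ‖v x‖ := by
          refine (norm_sub_le _ _).trans_eq ?_
          rw [norm_mul, norm_mul]
      _ ≤ (C * Real.exp (b * x)) * (Real.exp (-(b * x)) * R)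
          + (Real.exp (-(b * x)) * P) * (D * Real.exp (b * x)) := by
          have := (norm_nonneg _).trans h1
          have := (norm_nonneg _).trans h3
          gcongr
      _ = C * R + D * P := by linear_combination (C * R + D * P) * he
  have h0 : Tendsto (wronskian u v) atTop (𝓝 (wronskian u v x)) :=
    (tendsto_const_nhds (x := wronskian u v x)).congr fun y => hconst x y
  exact tendsto_nhds_unique h0 hlim

theorem deriv_jostSolution (hb : 0 < b) (hκ : -b < κ.re)
    (hV : Integrable (fun x : ℝ => (Real.exp (2 * b * |x|) : ℂ) * V x)) (x : ℝ) :
    deriv (jostSolution V κ) x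
      = Complex.exp (-(κ * x)) * (jostSlope V κ x - κ * jostAmplitude V κ x) :=
  (hasDerivAt_jostSolution hb hκ hV x).deriv

theorem norm_jostSolution_le (hb : 0 < b) (hκ : -b < κ.re)
    (hV : Integrable (fun x : ℝ => (Real.exp (2 * b * |x|) : ℂ) * V x)) (x : ℝ) :
    ‖jostSolution V κ x‖ ≤
      Real.exp (-κ.re * x) * (jostWeight b x * Real.exp (jostMass V b)) := by
  rw [jostSolution, norm_mul, Complex.norm_exp]
  have := norm_jostAmplitude_le hb hκ hV x
  simp only [Complex.neg_re, Complex.mul_re, Complex.ofReal_re, Complex.ofReal_im, mul_zero,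
    sub_zero, neg_mul]
  gcongr

theorem norm_jostSolution_le_of_nonneg (hb : 0 < b) (hκ : -b < κ.re)
    (hV : Integrable (fun x : ℝ => (Real.exp (2 * b * |x|) : ℂ) * V x)) {x : ℝ} (hx : 0 ≤ x) :
    ‖jostSolution V κ x‖ ≤ Real.exp (jostMass V b) * Real.exp (b * x) := by
  have h := norm_jostSolution_le hb hκ hV x
  rw [jostWeight_of_nonneg b hx, one_mul, mul_comm] at h
  refine h.trans (mul_le_mul_of_nonneg_left (Real.exp_le_exp.2 ?_) (Real.exp_pos _).le)
  nlinarith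

theorem locallyIntegrable_of_exp_mul
    (hV : Integrable (fun x : ℝ => (Real.exp (2 * b * |x|) : ℂ) * V x)) :
    LocallyIntegrable V volume := by
  have h2 : Continuous fun x : ℝ => (Real.exp (-(2 * b * |x|)) : ℂ) :=
    Complex.continuous_ofReal.comp (by fun_prop)
  have := hV.locallyIntegrable.continuous_smul h2
  refine this.congr (Eventually.of_forall fun x => ?_)
  simp only [smul_eq_mul]
  rw [← mul_assoc, ← Complex.ofReal_mul, ← Real.exp_add]
  simp

theorem isRightJost_jostSolution (hb : 0 < b) (hκ : -b < κ.re)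
    (hV : Integrable (fun x : ℝ => (Real.exp (2 * b * |x|) : ℂ) * V x)) :
    IsRightJost V κ b (jostSolution V κ) where
  differentiable x := (hasDerivAt_jostSolution hb hκ hV x).differentiableAt
  tail x := by
    rw [deriv_jostSolution hb hκ hV, jostSolution, jostSlope]
    have h : ∀ A I : ℂ, Complex.exp (-(κ * x)) * (-I - κ * A) + κ * (Complex.exp (-(κ * x)) * A)
        = -(Complex.exp (-(κ * x)) * I) := fun A I => by ring
    rw [h, ← integral_const_mul]
    congr 2
    ext y
    rw [jostSolution]
    have he : Complex.exp (-(κ * x)) * Complex.exp (-(2 * κ * (y - x)))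
        = Complex.exp (-(κ * (y - x))) * Complex.exp (-(κ * y)) := by
      rw [← Complex.exp_add, ← Complex.exp_add]; congr 1; ring
    linear_combination V y * jostAmplitude V κ y * he
  bound := ⟨Real.exp (jostMass V b), fun x hx => norm_jostSolution_le_of_nonneg hb hκ hV hx⟩
  integrable := by
    have hd : Differentiable ℝ (jostSolution V κ) :=
      fun x => (hasDerivAt_jostSolution hb hκ hV x).differentiableAt
    have hc : Continuous fun x : ℝ => (Real.exp (b * x) : ℂ) :=
      Complex.continuous_ofReal.comp (by fun_prop)
    have hl : LocallyIntegrable (fun y => (Real.exp (b * y) : ℂ) * (V y * jostSolution V κ y))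
        volume := by
      refine ((locallyIntegrable_of_exp_mul hV).continuous_smul
        (hc.mul hd.continuous)).congr (Eventually.of_forall fun x => ?_)
      simp only [smul_eq_mul, Pi.mul_apply]
      ring
    have h0 : IntegrableOn (fun y => (Real.exp (b * y) : ℂ) * (V y * jostSolution V κ y))
        (Set.Ioi 0) := by
      refine Integrable.mono' (((integrable_exp_mul_norm hV).const_mul
        (Real.exp (jostMass V b))).integrableOn) hl.aestronglyMeasurable.restrict ?_
      filter_upwards [ae_restrict_mem measurableSet_Ioi] with y hy
      have hy' : (0 : ℝ) < y := hy
      rw [norm_exp_mul_ofReal, norm_mul, abs_of_pos hy']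
      have h1 := norm_jostSolution_le_of_nonneg hb hκ hV hy'.le
      -- One factor `e^{by}` is the weight, the other the growth of the solution: this consumes the
      -- exponent `2 * b` in the hypothesis on `V`.
      have he : Real.exp (2 * b * y) = Real.exp (b * y) * Real.exp (b * y) := by
        rw [← Real.exp_add]; congr 1; ring
      calc _ ≤ Real.exp (b * y) * (‖V y‖ * (Real.exp (jostMass V b) * Real.exp (b * y))) := by
            gcongr
        _ = _ := by rw [he]; ring
    intro c
    have h1 : IntegrableOn (fun y => (Real.exp (b * y) : ℂ) * (V y * jostSolution V κ y))
        (Set.Icc c 0) := hl.integrableOn_isCompact isCompact_Icc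
    refine (h1.union h0).mono_set fun y hy => ?_
    have hy' : c < y := hy
    rcases le_or_gt y 0 with h | h
    · exact Or.inl ⟨hy'.le, h⟩
    · exact Or.inr h

theorem I_mul_sq (k : ℂ) : k ^ 2 = -(Complex.I * k) ^ 2 := by
  rw [mul_pow, Complex.I_sq]; ring

theorem isMuPlus_jostSolution (hb : 0 < b) (hκ : -b < (Complex.I * k).re)
    (hV : Integrable (fun x : ℝ => (Real.exp (2 * b * |x|) : ℂ) * V x)) :
    IsMuPlus V k (jostSolution V (Complex.I * k)) where
  solution := (isRightJost_jostSolution hb hκ hV).isSolution hκ (I_mul_sq k)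
  value := by
    refine (tendsto_jostAmplitude hb hκ hV).congr fun x => ?_
    rw [jostSolution, mul_right_comm, ← Complex.exp_add]
    simp
  slope := by
    have h := (tendsto_jostSlope hb hκ hV).sub
      ((tendsto_jostAmplitude hb hκ hV).const_mul (Complex.I * k))
    rw [zero_sub, mul_one] at h
    refine h.congr fun x => ?_
    rw [deriv_jostSolution hb hκ hV, mul_right_comm (Complex.exp _), ← Complex.exp_add]
    simp

theorem IsMuPlus.exists_ne_zero (hv : IsMuPlus V k v) : ∃ x, v x ≠ 0 := by
  by_contra! h
  have := hv.value
  simp only [h, zero_mul] at this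
  exact zero_ne_one (tendsto_nhds_unique tendsto_const_nhds this)

/-- Both solutions and their derivatives are `O(e^{-κx})` with `Re κ > 0`, so the constant Wronskian
is zero and the solutions are proportional; the normalisation at `+∞` makes the factor `1`. -/
theorem IsMuPlus.unique (hV : LocallyIntegrable V volume) (hk : k ∈ firstSheet)
    (hu : IsMuPlus V k u) (hv : IsMuPlus V k v) : u = v := by
  have hk' : k.im < 0 := hk
  have hW : wronskian u v 0 = 0 := by
    have h1 := (hu.value.mul hv.slope).sub (hu.slope.mul hv.value)
    have h2 : Tendsto (fun x : ℝ => Complex.exp (-(2 * (Complex.I * k) * x))) atTop (𝓝 0) := by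
      rw [tendsto_zero_iff_norm_tendsto_zero]
      have h3 : Tendsto (fun x : ℝ => Real.exp (-((-2 * k.im) * x))) atTop (𝓝 0) :=
        Real.tendsto_exp_neg_atTop_nhds_zero.comp (tendsto_id.const_mul_atTop (by linarith))
      refine h3.congr fun x => ?_
      rw [Complex.norm_exp]
      congr 1
      simp
    have h3 := h2.mul h1
    rw [zero_mul] at h3
    have h4 : Tendsto (fun _ : ℝ => wronskian u v 0) atTop (𝓝 0) := by
      refine h3.congr fun x => ?_
      rw [wronskian_eq hV hu.solution hv.solution 0 x, wronskian]
      have he : Complex.exp (-(2 * (Complex.I * k) * x)) *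
          (Complex.exp (Complex.I * k * x) * Complex.exp (Complex.I * k * x)) = 1 := by
        rw [← Complex.exp_add, ← Complex.exp_add, ← Complex.exp_zero]
        congr 1; ring
      linear_combination (u x * deriv v x - deriv u x * v x) * he
    exact tendsto_nhds_unique tendsto_const_nhds h4
  obtain ⟨c, hc⟩ := exists_eq_const_mul_of_wronskian_eq_zero hV hu.solution hv.solution hW
    hv.exists_ne_zero
  have h1 := hv.value.const_mul c
  have h2 : c * 1 = 1 := tendsto_nhds_unique (h1.congr fun x => by rw [hc x]; ring) hu.value
  rw [mul_one] at h2
  ext x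
  rw [hc x, h2, one_mul]

theorem IsMuMinus.comp_neg (hV : LocallyIntegrable V volume) (hu : IsMuMinus V k u) :
    IsMuPlus (fun x => V (-x)) k (fun x => u (-x)) where
  solution := hu.solution.comp_neg hV
  value := (hu.value.comp tendsto_neg_atTop_atBot).congr fun x => by simp
  slope := ((hu.slope.comp tendsto_neg_atTop_atBot).neg).congr fun x => by
    rw [deriv_comp_neg_apply]; simp

theorem IsMuPlus.comp_neg (hV : LocallyIntegrable V volume)
    (hu : IsMuPlus (fun x => V (-x)) k u) : IsMuMinus V k (fun x => u (-x)) where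
  solution := by simpa using hu.solution.comp_neg (locallyIntegrable_comp_neg hV)
  value := (hu.value.comp tendsto_neg_atBot_atTop).congr fun x => by simp
  slope := by
    have h := ((hu.slope.comp tendsto_neg_atBot_atTop).neg)
    rw [neg_neg] at h
    refine h.congr fun x => ?_
    rw [deriv_comp_neg_apply]; simp

theorem IsMuMinus.unique (hV : LocallyIntegrable V volume) (hk : k ∈ firstSheet)
    (hu : IsMuMinus V k u) (hv : IsMuMinus V k v) : u = v := by
  have h := (hu.comp_neg hV).unique (locallyIntegrable_comp_neg hV) hk (hv.comp_neg hV)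
  ext x
  simpa using congrFun h (-x)

theorem integrable_exp_mul_comp_neg
    (hV : Integrable (fun x : ℝ => (Real.exp (2 * b * |x|) : ℂ) * V x)) :
    Integrable (fun x : ℝ => (Real.exp (2 * b * |x|) : ℂ) * V (-x)) := by
  simpa using hV.comp_neg

end JostSolutions

/-! ### The Fourier pair `e^{-κ|t|}` and `1 / (κ² + ξ²)`. -/

section FourierOfExponential

variable {κ : ℂ}

theorem continuous_exp_neg_mul_abs (κ : ℂ) :
    Continuous fun t : ℝ => Complex.exp (-(κ * (|t| : ℝ))) := by
  have : Continuous fun t : ℝ => ((|t| : ℝ) : ℂ) := Complex.continuous_ofReal.comp continuous_abs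
  fun_prop

theorem exp_mul_I_mul_exp_abs_Ioi (κ : ℂ) (w : ℝ) : Set.EqOn
    (fun v : ℝ => Complex.exp (((-2 * Real.pi * v * w : ℝ) : ℂ) * Complex.I) •
      Complex.exp (-(κ * (|v| : ℝ))))
    (fun v : ℝ => Complex.exp (-(κ + 2 * Real.pi * w * Complex.I) * v)) (Set.Ioi 0) := by
  intro v hv
  have hv' : (0 : ℝ) < v := hv
  simp only [smul_eq_mul]
  rw [abs_of_pos hv', ← Complex.exp_add]
  congr 1
  push_cast
  ring

theorem exp_mul_I_mul_exp_abs_Iic (κ : ℂ) (w : ℝ) : Set.EqOn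
    (fun v : ℝ => Complex.exp (((-2 * Real.pi * v * w : ℝ) : ℂ) * Complex.I) •
      Complex.exp (-(κ * (|v| : ℝ))))
    (fun v : ℝ => Complex.exp ((κ - 2 * Real.pi * w * Complex.I) * v)) (Set.Iic 0) := by
  intro v hv
  have hv' : v ≤ (0 : ℝ) := hv
  simp only [smul_eq_mul]
  rw [abs_of_nonpos hv', ← Complex.exp_add]
  congr 1
  push_cast
  ring

theorem integrable_exp_neg_mul_abs (hκ : 0 < κ.re) :
    Integrable fun t : ℝ => Complex.exp (-(κ * (|t| : ℝ))) := by
  have h1 := (integrableOn_exp_mul_complex_Ioi (a := -(κ + 2 * Real.pi * (0 : ℝ) * Complex.I))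
    (by simpa using hκ) 0).congr_fun (exp_mul_I_mul_exp_abs_Ioi κ 0).symm measurableSet_Ioi
  have h2 := (integrableOn_exp_mul_complex_Iic (a := κ - 2 * Real.pi * (0 : ℝ) * Complex.I)
    (by simpa using hκ) 0).congr_fun (exp_mul_I_mul_exp_abs_Iic κ 0).symm measurableSet_Iic
  have h3 := h2.union h1
  rw [Set.Iic_union_Ioi, integrableOn_univ] at h3
  simpa using h3

theorem fourier_exp_neg_mul_abs (hκ : 0 < κ.re) (w : ℝ) :
    𝓕 (fun t : ℝ => Complex.exp (-(κ * (|t| : ℝ)))) w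
      = 2 * κ * (κ ^ 2 + ((2 * Real.pi * w : ℝ) : ℂ) ^ 2)⁻¹ := by
  have r1 : (-(κ + 2 * Real.pi * w * Complex.I)).re < 0 := by simpa using hκ
  have r2 : 0 < (κ - 2 * Real.pi * w * Complex.I).re := by simpa using hκ
  have i1 := (integrableOn_exp_mul_complex_Ioi r1 0).congr_fun
    (exp_mul_I_mul_exp_abs_Ioi κ w).symm measurableSet_Ioi
  have i2 := (integrableOn_exp_mul_complex_Iic r2 0).congr_fun
    (exp_mul_I_mul_exp_abs_Iic κ w).symm measurableSet_Iic
  rw [Real.fourier_real_eq_integral_exp_smul, ← intervalIntegral.integral_Iic_add_Ioi i2 i1,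
    setIntegral_congr_fun measurableSet_Iic (exp_mul_I_mul_exp_abs_Iic κ w),
    setIntegral_congr_fun measurableSet_Ioi (exp_mul_I_mul_exp_abs_Ioi κ w),
    integral_exp_mul_complex_Ioi r1, integral_exp_mul_complex_Iic r2]
  have n1 : κ + 2 * Real.pi * w * Complex.I ≠ 0 := by
    intro h; rw [h] at r1; simp at r1
  have n2 : κ - 2 * Real.pi * w * Complex.I ≠ 0 := by
    intro h; rw [h] at r2; simp at r2
  have e : κ ^ 2 + ((2 * Real.pi * w : ℝ) : ℂ) ^ 2
      = (κ - 2 * Real.pi * w * Complex.I) * (κ + 2 * Real.pi * w * Complex.I) := by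
    push_cast
    linear_combination ((2 * Real.pi * w) ^ 2 : ℂ) * Complex.I_sq
  rw [e]
  simp only [Complex.ofReal_zero, mul_zero, Complex.exp_zero]
  field_simp
  ring

/-- Both factors of `κ² + ξ² = (κ - iξ)(κ + iξ)` have real part `κ.re`. -/
theorem re_le_norm_sq_add_sq (hκ : 0 < κ.re) (ξ : ℝ) : κ.re ^ 2 ≤ ‖κ ^ 2 + (ξ : ℂ) ^ 2‖ := by
  have e : κ ^ 2 + (ξ : ℂ) ^ 2 = (κ - ξ * Complex.I) * (κ + ξ * Complex.I) := by
    linear_combination ((ξ : ℂ) ^ 2) * Complex.I_sq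
  have h1 := Complex.re_le_norm (κ - ξ * Complex.I)
  have h2 := Complex.re_le_norm (κ + ξ * Complex.I)
  simp only [Complex.sub_re, Complex.add_re, Complex.mul_re, Complex.ofReal_re, Complex.I_re,
    mul_zero, Complex.ofReal_im, Complex.I_im, zero_mul, sub_zero, add_zero] at h1 h2
  rw [e, norm_mul, sq]
  gcongr

theorem sq_add_sq_ne_zero (hκ : 0 < κ.re) (ξ : ℝ) : κ ^ 2 + (ξ : ℂ) ^ 2 ≠ 0 := by
  have := re_le_norm_sq_add_sq hκ ξ
  rw [← norm_pos_iff]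
  have : 0 < κ.re ^ 2 := by positivity
  linarith

theorem integrable_inv_sq_add_sq (hκ : 0 < κ.re) :
    Integrable fun ξ : ℝ => (κ ^ 2 + (ξ : ℂ) ^ 2)⁻¹ := by
  have hc : Continuous fun ξ : ℝ => (κ ^ 2 + (ξ : ℂ) ^ 2)⁻¹ :=
    Continuous.inv₀ (by fun_prop) (sq_add_sq_ne_zero hκ)
  have hδ : 0 < κ.re ^ 2 := by positivity
  -- With `N = ‖κ² + ξ²‖`, one has `1 + ξ² ≤ N + (1 + ‖κ‖²)`, and `N ≥ κ.re²` absorbs the last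
  -- bracket into a multiple of `N`.
  refine (integrable_inv_one_add_sq.const_mul (1 + (1 + ‖κ‖ ^ 2) / κ.re ^ 2)).mono'
    hc.aestronglyMeasurable (Eventually.of_forall fun ξ => ?_)
  rw [norm_inv]
  have h1 := re_le_norm_sq_add_sq hκ ξ
  have hpos : 0 < ‖κ ^ 2 + (ξ : ℂ) ^ 2‖ := hδ.trans_le h1
  rw [← div_eq_mul_inv, le_div_iff₀ (by positivity), inv_mul_le_iff₀ hpos]
  have h2 : ξ ^ 2 ≤ ‖κ ^ 2 + (ξ : ℂ) ^ 2‖ + ‖κ‖ ^ 2 := by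
    have := norm_sub_le (κ ^ 2 + (ξ : ℂ) ^ 2) (κ ^ 2)
    rw [add_sub_cancel_left, norm_pow, norm_pow, Complex.norm_real, Real.norm_eq_abs, sq_abs] at this
    exact this
  have h3 : 1 + ‖κ‖ ^ 2 ≤ ‖κ ^ 2 + (ξ : ℂ) ^ 2‖ * ((1 + ‖κ‖ ^ 2) / κ.re ^ 2) := by
    calc 1 + ‖κ‖ ^ 2 = κ.re ^ 2 * ((1 + ‖κ‖ ^ 2) / κ.re ^ 2) := by field_simp
      _ ≤ _ := by gcongr
  rw [mul_add]
  linarith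

/-- The Fourier integral of `1 / (κ² + ξ²)`. -/
theorem integral_exp_mul_inv_sq_add_sq (hκ : 0 < κ.re) (t : ℝ) :
    ∫ ξ : ℝ, Complex.exp (Complex.I * t * ξ) * (κ ^ 2 + (ξ : ℂ) ^ 2)⁻¹
      = Real.pi / κ * Complex.exp (-(κ * (|t| : ℝ))) := by
  have hπ : (0 : ℝ) < 2 * Real.pi := by positivity
  have hκ0 : κ ≠ 0 := by
    intro h; rw [h] at hκ; simp at hκ
  have hF : 𝓕 (fun t : ℝ => Complex.exp (-(κ * (|t| : ℝ))))
      = fun w : ℝ => 2 * κ * (κ ^ 2 + ((2 * Real.pi * w : ℝ) : ℂ) ^ 2)⁻¹ :=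
    funext (fourier_exp_neg_mul_abs hκ)
  have hi : Integrable (𝓕 (fun t : ℝ => Complex.exp (-(κ * (|t| : ℝ))))) := by
    rw [hF]
    exact ((integrable_inv_sq_add_sq hκ).comp_mul_left' hπ.ne').const_mul _
  -- Fourier inversion takes the place of a residue computation; the substitution `ξ = 2πv` adjusts
  -- the normalisation.
  have h := congrFun ((continuous_exp_neg_mul_abs κ).fourierInv_fourier_eq
    (integrable_exp_neg_mul_abs hκ) hi) t
  rw [hF, Real.fourierInv_eq'] at h
  have e : (fun v : ℝ => Complex.exp (((2 * Real.pi * inner ℝ v t : ℝ) : ℂ) * Complex.I) •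
      (2 * κ * (κ ^ 2 + ((2 * Real.pi * v : ℝ) : ℂ) ^ 2)⁻¹))
      = fun v : ℝ => 2 * κ * (fun ξ : ℝ => Complex.exp (Complex.I * t * ξ) *
        (κ ^ 2 + (ξ : ℂ) ^ 2)⁻¹) (2 * Real.pi * v) := by
    ext v
    simp only [smul_eq_mul]
    have : Complex.exp (((2 * Real.pi * inner ℝ v t : ℝ) : ℂ) * Complex.I)
        = Complex.exp (Complex.I * t * ((2 * Real.pi * v : ℝ) : ℂ)) := by
      congr 1
      simp only [RCLike.inner_apply, conj_trivial]
      push_cast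
      ring
    rw [this]
    ring
  rw [e, integral_const_mul, Measure.integral_comp_mul_left (fun ξ : ℝ =>
    Complex.exp (Complex.I * t * ξ) * (κ ^ 2 + (ξ : ℂ) ^ 2)⁻¹) (2 * Real.pi), abs_of_pos (inv_pos.2 hπ)] at h
  rw [← h, Complex.real_smul]
  have : (Real.pi : ℂ) ≠ 0 := Complex.ofReal_ne_zero.2 Real.pi_ne_zero
  push_cast
  field_simp

end FourierOfExponential

/-! ### The continued resolvent as a Green integral. -/

section Resolvent

variable {ψ : ℝ → ℂ} {κ k : ℂ} {b : ℝ}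

/-- The integral operator with the outgoing Green kernel `-e^{-κ|x-y|} / (2κ)`. -/
def greenIntegral (κ : ℂ) (ψ : ℝ → ℂ) (x : ℝ) : ℂ :=
  -(1 / (2 * κ)) * ∫ y, Complex.exp (-(κ * (|x - y| : ℝ))) * ψ y

/-- Fubini, with the integrable majorant `|κ² + ξ²|⁻¹ |ψ(y)|`, leaves the Fourier integral of `1 /
(κ² + ξ²)` at `x - y`. -/
theorem freeResolvent_eq_greenIntegral (hk : 0 < (Complex.I * k).re) (hψ : Integrable ψ) (x : ℝ) :
    freeResolvent (k ^ 2) ψ x = greenIntegral (Complex.I * k) ψ x := by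
  set κ := Complex.I * k with hκ
  set c : ℂ := ((1 / Real.sqrt (2 * Real.pi) : ℝ) : ℂ) with hc
  have hcc : c * c = 1 / (2 * Real.pi) := by
    rw [hc, ← Complex.ofReal_mul, div_mul_div_comm, Real.mul_self_sqrt (by positivity)]
    push_cast; ring
  set g : ℝ → ℂ := fun ξ => (κ ^ 2 + (ξ : ℂ) ^ 2)⁻¹ with hg
  have hgi : Integrable g := integrable_inv_sq_add_sq hk
  have hinv : ∀ ξ : ℝ, (k ^ 2 - (ξ : ℂ) ^ 2)⁻¹ = -g ξ := by
    intro ξ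
    rw [I_mul_sq k, hg, ← neg_add', inv_neg]
  have h1 : freeResolvent (k ^ 2) ψ x
      = -(c * c) * ∫ ξ : ℝ, ∫ y : ℝ, Complex.exp (Complex.I * (x - y : ℝ) * ξ) * (g ξ * ψ y) := by
    have hin : ∀ ξ : ℝ, (k ^ 2 - (ξ : ℂ) ^ 2)⁻¹ * Complex.exp (Complex.I * x * ξ) * fourier ψ ξ
        = -c * ∫ y : ℝ, Complex.exp (Complex.I * (x - y : ℝ) * ξ) * (g ξ * ψ y) := by
      intro ξ
      rw [hinv, fourier, ← hc, ← integral_const_mul, ← integral_const_mul, ← integral_const_mul]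
      congr 1
      ext y
      have he : Complex.exp (Complex.I * x * ξ) * Complex.exp (-(Complex.I * y * ξ))
          = Complex.exp (Complex.I * (x - y : ℝ) * ξ) := by
        rw [← Complex.exp_add]; congr 1; push_cast; ring
      rw [← he]
      ring
    rw [freeResolvent, ← hc]
    simp_rw [hin]
    rw [integral_const_mul]
    ring
  have hswap : ∫ ξ : ℝ, ∫ y : ℝ, Complex.exp (Complex.I * (x - y : ℝ) * ξ) * (g ξ * ψ y)
      = ∫ y : ℝ, ∫ ξ : ℝ, Complex.exp (Complex.I * (x - y : ℝ) * ξ) * (g ξ * ψ y) := by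
    apply integral_integral_swap
    have hcont : Continuous fun p : ℝ × ℝ => Complex.exp (Complex.I * (x - p.2 : ℝ) * p.1) := by
      fun_prop
    refine (hgi.mul_prod hψ).bdd_mul (c := 1) hcont.aestronglyMeasurable
      (Eventually.of_forall fun p => ?_)
    rw [Complex.norm_exp]
    simp
  have h2 : ∀ y : ℝ, ∫ ξ : ℝ, Complex.exp (Complex.I * (x - y : ℝ) * ξ) * (g ξ * ψ y)
      = Real.pi / κ * (Complex.exp (-(κ * (|x - y| : ℝ))) * ψ y) := by
    intro y
    simp_rw [← mul_assoc]
    rw [integral_mul_const, integral_exp_mul_inv_sq_add_sq hk]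
  rw [h1, hswap, hcc]
  simp_rw [h2]
  rw [integral_const_mul, greenIntegral]
  have : (Real.pi : ℂ) ≠ 0 := Complex.ofReal_ne_zero.2 Real.pi_ne_zero
  have : κ ≠ 0 := by
    intro h; rw [h] at hk; simp at hk
  field_simp

theorem integrable_of_integrable_exp_mul_abs (hb : 0 < b)
    (hψ : Integrable fun y : ℝ => (Real.exp (b * |y|) : ℂ) * ψ y) : Integrable ψ := by
  have hm : AEStronglyMeasurable ψ volume :=
    aestronglyMeasurable_of_exp_mul (c := fun y => b * |y|) (by fun_prop) hψ.aestronglyMeasurable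
  refine hψ.norm.mono' hm (Eventually.of_forall fun y => ?_)
  rw [norm_exp_mul_ofReal]
  exact le_mul_of_one_le_left (norm_nonneg _) (Real.one_le_exp (by positivity))

theorem integrable_exp_mul (hκ : |κ.re| ≤ b)
    (hψ : Integrable fun y : ℝ => (Real.exp (b * |y|) : ℂ) * ψ y) :
    Integrable fun y : ℝ => Complex.exp (κ * y) * ψ y := by
  have hm : AEStronglyMeasurable ψ volume :=
    aestronglyMeasurable_of_exp_mul (c := fun y => b * |y|) (by fun_prop) hψ.aestronglyMeasurable
  have hc : Continuous fun y : ℝ => Complex.exp (κ * y) := by fun_prop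
  refine hψ.norm.mono' (hc.aestronglyMeasurable.mul hm) (Eventually.of_forall fun y => ?_)
  rw [norm_exp_mul_ofReal, norm_mul, Complex.norm_exp]
  refine mul_le_mul_of_nonneg_right (Real.exp_le_exp.2 ?_) (norm_nonneg _)
  simp only [Complex.mul_re, Complex.ofReal_re, Complex.ofReal_im, mul_zero, sub_zero]
  calc κ.re * y ≤ |κ.re * y| := le_abs_self _
    _ = |κ.re| * |y| := abs_mul _ _
    _ ≤ b * |y| := by gcongr

theorem norm_exp_neg_mul_abs_le (hb : 0 < b) (hκ : -b < κ.re) (x y : ℝ) :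
    ‖Complex.exp (-(κ * (|x - y| : ℝ)))‖ ≤ Real.exp (b * |x|) * Real.exp (b * |y|) := by
  rw [Complex.norm_exp, ← Real.exp_add]
  apply Real.exp_le_exp.2
  simp only [Complex.neg_re, Complex.mul_re, Complex.ofReal_re, Complex.ofReal_im, mul_zero,
    sub_zero]
  have h1 : |x - y| ≤ |x| + |y| := abs_sub x y
  nlinarith [abs_nonneg (x - y)]

theorem integrable_exp_neg_mul_abs_mul (hb : 0 < b) (hκ : -b < κ.re)
    (hψ : Integrable fun y : ℝ => (Real.exp (b * |y|) : ℂ) * ψ y) (x : ℝ) :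
    Integrable fun y : ℝ => Complex.exp (-(κ * (|x - y| : ℝ))) * ψ y := by
  have hm : AEStronglyMeasurable ψ volume :=
    aestronglyMeasurable_of_exp_mul (c := fun y => b * |y|) (by fun_prop) hψ.aestronglyMeasurable
  have hc : Continuous fun y : ℝ => Complex.exp (-(κ * (|x - y| : ℝ))) :=
    (continuous_exp_neg_mul_abs κ).comp (continuous_const.sub continuous_id)
  refine (hψ.norm.const_mul (Real.exp (b * |x|))).mono' (hc.aestronglyMeasurable.mul hm)
    (Eventually.of_forall fun y => ?_)
  rw [norm_mul, norm_exp_mul_ofReal, ← mul_assoc]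
  exact mul_le_mul_of_nonneg_right (norm_exp_neg_mul_abs_le hb hκ x y) (norm_nonneg _)

theorem exp_mul_abs_add_exp (κ : ℂ) (t : ℝ) :
    Complex.exp (-(κ * (|t| : ℝ))) + Complex.exp (κ * (|t| : ℝ))
      = Complex.exp (-(κ * t)) + Complex.exp (κ * t) := by
  rcases abs_choice t with h | h <;> rw [h]
  push_cast
  rw [mul_neg, neg_neg, add_comm]

/-- On the cut the limit is by dominated convergence, the kernel `e^{-κ|x-y|}` having modulus at
most `1` on the first sheet. On the second sheet the resolvent is the Green integral for `-κ`, and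
the residue term is exactly the difference, because `e^{-κ|t|} + e^{κ|t|} = e^{-κt} + e^{κt}`. -/
theorem continuedResolvent_eq_greenIntegral (hb : 0 < b) (hk : k ≠ 0)
    (hκ : -b < (Complex.I * k).re)
    (hψ : Integrable fun y : ℝ => (Real.exp (b * |y|) : ℂ) * ψ y) (x : ℝ) :
    continuedResolvent k ψ x = greenIntegral (Complex.I * k) ψ x := by
  have hψ' := integrable_of_integrable_exp_mul_abs hb hψ
  have hκ' : -b < -k.im := by simpa using hκ
  rw [continuedResolvent]
  split_ifs with h1 h2
  · exact freeResolvent_eq_greenIntegral (by simpa using h1) hψ' x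
  · have hne : (𝓝[firstSheet] k).NeBot := by
      rw [← mem_closure_iff_nhdsWithin_neBot, firstSheet, Complex.closure_setOfPred_im_lt]
      exact h2.le
    apply Tendsto.limUnder_eq
    have hlim : Tendsto (fun z : ℂ => greenIntegral (Complex.I * z) ψ x) (𝓝[firstSheet] k)
        (𝓝 (greenIntegral (Complex.I * k) ψ x)) := by
      refine Tendsto.mul ?_ ?_
      · have : ContinuousAt (fun z : ℂ => -(1 / (2 * (Complex.I * z)))) k := by
          have : 2 * (Complex.I * k) ≠ 0 := by simp [hk]
          fun_prop (disch := assumption)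
        exact this.tendsto.mono_left nhdsWithin_le_nhds
      · refine tendsto_integral_filter_of_dominated_convergence (fun y => ‖ψ y‖) ?_ ?_ hψ'.norm ?_
        · refine Eventually.of_forall fun z => ?_
          exact ((continuous_exp_neg_mul_abs (Complex.I * z)).comp
            (continuous_const.sub continuous_id)).aestronglyMeasurable.mul
              hψ'.aestronglyMeasurable
        · filter_upwards [self_mem_nhdsWithin] with z hz
          refine Eventually.of_forall fun y => ?_
          have hz' : z.im < 0 := hz
          rw [norm_mul]
          refine mul_le_of_le_one_left (norm_nonneg _) ?_
          rw [Complex.norm_exp, Real.exp_le_one_iff]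
          simp
          nlinarith [abs_nonneg (x - y)]
        · refine Eventually.of_forall fun y => ?_
          have : Continuous fun z : ℂ => Complex.exp (-(Complex.I * z * (|x - y| : ℝ))) * ψ y := by
            fun_prop
          exact this.continuousAt.tendsto.mono_left nhdsWithin_le_nhds
    refine hlim.congr' ?_
    filter_upwards [self_mem_nhdsWithin] with z hz
    have hz' : z.im < 0 := hz
    exact (freeResolvent_eq_greenIntegral (by simpa using hz') hψ' x).symm
  · have h3 : 0 < k.im := lt_of_le_of_ne (not_lt.1 h1) (Ne.symm h2)
    have hfree : freeResolvent (k ^ 2) ψ x = greenIntegral (-(Complex.I * k)) ψ x := by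
      -- The point `-k` lies on the first sheet and has the same square as `k`.
      have := freeResolvent_eq_greenIntegral (k := -k) (by simpa using h3) hψ' x
      rwa [neg_sq, mul_neg] at this
    set κ := Complex.I * k with hκdef
    have hκre : κ.re = -k.im := by simp [hκdef]
    have habs : |κ.re| ≤ b := by
      rw [hκre, abs_neg, abs_of_pos h3]; linarith
    have i1 := integrable_exp_neg_mul_abs_mul hb hκ hψ x
    have i2 := integrable_exp_neg_mul_abs_mul (κ := -κ) hb
      (by rw [Complex.neg_re, hκre]; linarith) hψ x
    have i3 := (integrable_exp_mul (κ := -κ) (by rwa [Complex.neg_re, abs_neg]) hψ).const_mul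
      (Complex.exp (κ * x))
    have i4 := (integrable_exp_mul habs hψ).const_mul (Complex.exp (-(κ * x)))
    have hsum : (∫ y, Complex.exp (-(κ * (|x - y| : ℝ))) * ψ y)
        + (∫ y, Complex.exp (-(-κ * (|x - y| : ℝ))) * ψ y)
        = Complex.exp (κ * x) * (∫ y : ℝ, Complex.exp (-κ * y) * ψ y)
          + Complex.exp (-(κ * x)) * (∫ y : ℝ, Complex.exp (κ * y) * ψ y) := by
      rw [← integral_const_mul, ← integral_const_mul, ← integral_add i1 i2, ← integral_add i3 i4]
      congr 1
      ext y
      have e1 := exp_mul_abs_add_exp κ (x - y)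
      have e2 : Complex.exp (κ * x) * Complex.exp (-κ * y) = Complex.exp (κ * (x - y : ℝ)) := by
        rw [← Complex.exp_add]; congr 1; push_cast; ring
      have e3 : Complex.exp (-(κ * x)) * Complex.exp (κ * y)
          = Complex.exp (-(κ * (x - y : ℝ))) := by
        rw [← Complex.exp_add]; congr 1; push_cast; ring
      rw [neg_mul, neg_neg]
      linear_combination ψ y * e1 - ψ y * e2 - ψ y * e3
    have f1 : fourier ψ k = ((1 / Real.sqrt (2 * Real.pi) : ℝ) : ℂ) *
        ∫ y : ℝ, Complex.exp (-κ * y) * ψ y := by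
      rw [fourier]
      congr 2
      ext y
      rw [mul_comm]
      congr 2
      rw [hκdef]; ring
    have f2 : fourier ψ (-k) = ((1 / Real.sqrt (2 * Real.pi) : ℝ) : ℂ) *
        ∫ y : ℝ, Complex.exp (κ * y) * ψ y := by
      rw [fourier]
      congr 2
      ext y
      rw [mul_comm]
      congr 2
      rw [hκdef]; ring
    have hs : ((Real.sqrt (2 * Real.pi) : ℝ) : ℂ) * ((Real.sqrt (2 * Real.pi) : ℝ) : ℂ)
        = 2 * Real.pi := by
      rw [← Complex.ofReal_mul, Real.mul_self_sqrt (by positivity)]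
      push_cast; ring
    have hs0 : ((Real.sqrt (2 * Real.pi) : ℝ) : ℂ) ≠ 0 :=
      Complex.ofReal_ne_zero.2 (by positivity)
    rw [hfree, f1, f2, greenIntegral, greenIntegral]
    set A := ∫ y, Complex.exp (-(κ * (|x - y| : ℝ))) * ψ y
    set B := ∫ y, Complex.exp (-(-κ * (|x - y| : ℝ))) * ψ y
    set P := ∫ y : ℝ, Complex.exp (-κ * y) * ψ y
    set R := ∫ y : ℝ, Complex.exp (κ * y) * ψ y
    have hA : A = Complex.exp (κ * x) * P + Complex.exp (-(κ * x)) * R - B := by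
      rw [← hsum]; ring
    have hπ : (Real.pi : ℂ) ≠ 0 := Complex.ofReal_ne_zero.2 Real.pi_ne_zero
    have hcoef : (Real.pi : ℂ) * Complex.I / ((Real.sqrt (2 * Real.pi) : ℝ) : ℂ) * k⁻¹
        * ((1 / Real.sqrt (2 * Real.pi) : ℝ) : ℂ) = -(1 / (2 * κ)) := by
      rw [hκdef]
      push_cast
      field_simp
      rw [Complex.I_sq, sq, hs]
      field_simp
    rw [hA]
    have h2κ : -(1 / (2 * -κ)) = 1 / (2 * κ) := by
      rw [mul_neg, div_neg, neg_neg]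
    rw [h2κ]
    linear_combination (Complex.exp (κ * x) * P + Complex.exp (-(κ * x)) * R) * hcoef

end Resolvent

/-! ### Green integrals and solutions outgoing at both ends. -/

section Green

variable {V φ u : ℝ → ℂ} {κ : ℂ} {b : ℝ}

theorem integrable_exp_mul_abs_comp_neg
    (hφ : Integrable fun y : ℝ => (Real.exp (b * |y|) : ℂ) * φ y) :
    Integrable fun y : ℝ => (Real.exp (b * |y|) : ℂ) * φ (-y) := by
  simpa using hφ.comp_neg

theorem integrableOn_Ioi_exp_mul (hb : 0 < b)
    (hφ : Integrable fun y : ℝ => (Real.exp (b * |y|) : ℂ) * φ y) (c : ℝ) :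
    IntegrableOn (fun y : ℝ => (Real.exp (b * y) : ℂ) * φ y) (Set.Ioi c) := by
  have h := integrable_exp_mul (κ := (b : ℂ)) (by simp [abs_of_pos hb]) hφ
  refine (h.congr (Eventually.of_forall fun y => ?_)).integrableOn
  simp only
  push_cast
  rfl

theorem isPrimitive_integral_Iic {f : ℝ → ℂ} (hf : ∀ x, IntegrableOn f (Set.Iic x)) :
    IsPrimitive (fun x => ∫ y in Set.Iic x, f y) f :=
  ⟨fun x => ⟨Set.Iic (x + 1), Iic_mem_nhds (by linarith), hf _⟩,
    fun x y => intervalIntegral.integral_Iic_sub_Iic (hf x) (hf y)⟩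

theorem integrableOn_Iic_exp_mul (hb : 0 < b) (hκ : -b < κ.re)
    (hφ : Integrable fun y : ℝ => (Real.exp (b * |y|) : ℂ) * φ y) (c : ℝ) :
    IntegrableOn (fun y : ℝ => Complex.exp (κ * y) * φ y) (Set.Iic c) := by
  have h := integrableOn_exp_neg_mul hκ
    (integrableOn_Ioi_exp_mul hb (integrable_exp_mul_abs_comp_neg hφ) (-c))
  simpa using Iff.mpr integrableOn_Iic_iff_integrableOn_Iio h.comp_neg_Iio

theorem greenIntegral_eq (hb : 0 < b) (hκ : -b < κ.re)
    (hφ : Integrable fun y : ℝ => (Real.exp (b * |y|) : ℂ) * φ y) (x : ℝ) :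
    greenIntegral κ φ x = -(1 / (2 * κ)) *
      (Complex.exp (-κ * x) * (∫ y in Set.Iic x, Complex.exp (κ * y) * φ y)
        + Complex.exp (κ * x) * ∫ y in Set.Ioi x, Complex.exp (-(κ * y)) * φ y) := by
  have hi := integrable_exp_neg_mul_abs_mul hb hκ hφ x
  rw [greenIntegral, ← intervalIntegral.integral_Iic_add_Ioi hi.integrableOn hi.integrableOn,
    ← integral_const_mul, ← integral_const_mul]
  congr 2
  · refine setIntegral_congr_fun measurableSet_Iic fun y hy => ?_
    have hy' : y ≤ x := hy
    rw [abs_of_nonneg (by linarith), ← mul_assoc, ← Complex.exp_add]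
    congr 2
    push_cast; ring
  · refine setIntegral_congr_fun measurableSet_Ioi fun y hy => ?_
    have hy' : x < y := hy
    rw [abs_of_neg (by linarith), ← mul_assoc, ← Complex.exp_add]
    congr 2
    push_cast; ring

/-- The two endpoint terms in `φ x` cancel, so the almost everywhere derivative is continuous and
hence a derivative at every point. -/
theorem hasDerivAt_greenIntegral (hb : 0 < b) (hκ : -b < κ.re) (hκ0 : κ ≠ 0)
    (hφ : Integrable fun y : ℝ => (Real.exp (b * |y|) : ℂ) * φ y) (x : ℝ) :
    HasDerivAt (greenIntegral κ φ)
      (1 / 2 * (Complex.exp (-κ * x) * (∫ y in Set.Iic x, Complex.exp (κ * y) * φ y)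
        - Complex.exp (κ * x) * ∫ y in Set.Ioi x, Complex.exp (-(κ * y)) * φ y)) x := by
  have hP : IsPrimitive (fun x : ℝ => ∫ y in Set.Iic x, Complex.exp (κ * y) * φ y) _ :=
    isPrimitive_integral_Iic (integrableOn_Iic_exp_mul hb hκ hφ)
  have hQ : IsPrimitive (fun x : ℝ => ∫ y in Set.Ioi x, Complex.exp (-(κ * y)) * φ y) _ :=
    isPrimitive_integral_Ioi fun c => integrableOn_exp_neg_mul hκ (integrableOn_Ioi_exp_mul hb hφ c)
  have h := (((isPrimitive_exp_mul (-κ)).mul hP).add ((isPrimitive_exp_mul κ).mul hQ)).const_mul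
    (-(1 / (2 * κ)))
  have h' := h.congr' (g := greenIntegral κ φ) (g' := fun x : ℝ =>
    1 / 2 * (Complex.exp (-κ * x) * (∫ y in Set.Iic x, Complex.exp (κ * y) * φ y)
        - Complex.exp (κ * x) * ∫ y in Set.Ioi x, Complex.exp (-(κ * y)) * φ y))
    (fun x => (greenIntegral_eq hb hκ hφ x).symm) (fun x => ?_)
  · refine h'.hasDerivAt ?_ x
    have := hP.continuous
    have := hQ.continuous
    fun_prop
  · have e1 : Complex.exp (-κ * x) * Complex.exp (κ * x) = 1 := by
      rw [← Complex.exp_add]; simp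
    have e2 : Complex.exp (κ * x) * Complex.exp (-(κ * x)) = 1 := by
      rw [← Complex.exp_add]; simp
    have e3 : 1 / (2 * κ) * κ = 1 / 2 := by field_simp
    generalize 1 / (2 * κ) = d at *
    linear_combination -d * φ x * e1 + d * φ x * e2 +
      (Complex.exp (-κ * x) * (∫ y in Set.Iic x, Complex.exp (κ * y) * φ y)
        - Complex.exp (κ * x) * ∫ y in Set.Ioi x, Complex.exp (-(κ * y)) * φ y) * e3

theorem norm_greenIntegral_le (hb : 0 < b) (hκ : -b < κ.re)
    (hφ : Integrable fun y : ℝ => (Real.exp (b * |y|) : ℂ) * φ y) (x : ℝ) :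
    ‖greenIntegral κ φ x‖ ≤ ‖-(1 / (2 * κ))‖ *
      (Real.exp (b * |x|) * ∫ y, ‖(Real.exp (b * |y|) : ℂ) * φ y‖) := by
  rw [greenIntegral, norm_mul]
  refine mul_le_mul_of_nonneg_left ?_ (norm_nonneg _)
  rw [← integral_const_mul]
  refine norm_integral_le_of_norm_le (hφ.norm.const_mul _) (Eventually.of_forall fun y => ?_)
  rw [norm_mul, norm_exp_mul_ofReal, ← mul_assoc]
  exact mul_le_mul_of_nonneg_right (norm_exp_neg_mul_abs_le hb hκ x y) (norm_nonneg _)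

theorem greenIntegral_congr_ae {ψ : ℝ → ℂ} (h : φ =ᵐ[volume] ψ) (x : ℝ) :
    greenIntegral κ φ x = greenIntegral κ ψ x := by
  rw [greenIntegral, greenIntegral]
  congr 1
  exact integral_congr_ae (h.mono fun y hy => by simp only [hy])

theorem greenIntegral_comp_neg (κ : ℂ) (φ : ℝ → ℂ) (x : ℝ) :
    greenIntegral κ (fun y => φ (-y)) x = greenIntegral κ φ (-x) := by
  rw [greenIntegral, greenIntegral, ← integral_neg_eq_self]
  congr 2
  ext y
  have : |x - -y| = |-x - y| := by rw [← abs_neg]; congr 1; ring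
  rw [this, neg_neg]

/-- In `u' + κu` the integral over `(-∞, x]` drops out, leaving `-e^{κx} ∫_x^∞ e^{-κy} φ`, where `φ
= V u`. -/
theorem isRightJost_greenIntegral (hb : 0 < b) (hκ : -b < κ.re) (hκ0 : κ ≠ 0)
    (hφ : Integrable fun y : ℝ => (Real.exp (b * |y|) : ℂ) * φ y)
    (h : ∀ᵐ x, φ x = V x * greenIntegral κ φ x) : IsRightJost V κ b (greenIntegral κ φ) where
  differentiable x := (hasDerivAt_greenIntegral hb hκ hκ0 hφ x).differentiableAt
  tail x := by
    have h1 : ∫ y in Set.Ioi x, Complex.exp (-(κ * (y - x))) * (V y * greenIntegral κ φ y)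
        = Complex.exp (κ * x) * ∫ y in Set.Ioi x, Complex.exp (-(κ * y)) * φ y := by
      rw [← integral_const_mul]
      refine integral_congr_ae (ae_restrict_of_ae (h.mono fun y hy => ?_))
      simp only
      rw [← hy, ← mul_assoc, ← Complex.exp_add]
      congr 2
      ring
    rw [(hasDerivAt_greenIntegral hb hκ hκ0 hφ x).deriv, greenIntegral_eq hb hκ hφ, h1]
    field_simp
    ring
  bound := by
    refine ⟨‖-(1 / (2 * κ))‖ * ∫ y, ‖(Real.exp (b * |y|) : ℂ) * φ y‖, fun x hx => ?_⟩
    refine (norm_greenIntegral_le hb hκ hφ x).trans_eq ?_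
    rw [abs_of_nonneg hx]; ring
  integrable c := by
    refine (integrableOn_Ioi_exp_mul hb hφ c).congr (ae_restrict_of_ae (h.mono fun y hy => ?_))
    simp only
    rw [← hy]

theorem IsRightJost.const_mul (hu : IsRightJost V κ b u) (c : ℂ) :
    IsRightJost V κ b (fun x => c * u x) where
  differentiable := hu.differentiable.const_mul c
  tail x := by
    have h : ∀ y : ℝ, Complex.exp (-(κ * (y - x))) * (V y * (c * u y))
        = c * (Complex.exp (-(κ * (y - x))) * (V y * u y)) := fun y => by ring
    simp_rw [h]
    rw [integral_const_mul, ((hu.differentiable x).hasDerivAt.const_mul c).deriv]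
    linear_combination c * hu.tail x
  bound := by
    obtain ⟨C, hC⟩ := hu.bound
    refine ⟨‖c‖ * C, fun x hx => ?_⟩
    rw [norm_mul, mul_assoc]
    exact mul_le_mul_of_nonneg_left (hC x hx) (norm_nonneg c)
  integrable d := ((hu.integrable d).const_mul c).congr (Eventually.of_forall fun y => by
    simp only; ring)

/-- A solution that is outgoing at both ends is the Green integral of `V u`. -/
theorem IsRightJost.greenIntegral_eq (hb : 0 < b) (hκ : -b < κ.re) (hκ0 : κ ≠ 0)
    (hu : IsRightJost V κ b u) (hu' : IsRightJost (fun x => V (-x)) κ b (fun x => u (-x)))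
    (hi : Integrable fun y : ℝ => (Real.exp (b * |y|) : ℂ) * (V y * u y)) (x : ℝ) :
    greenIntegral κ (fun y => V y * u y) x = u x := by
  have h1 := hu.tail_eq x
  have h2 := hu'.tail_eq (-x)
  rw [deriv_comp_neg_apply, neg_neg] at h2
  have h3 : ∫ y in Set.Ioi (-x), Complex.exp (-(κ * y)) * (V (-y) * u (-y))
      = ∫ y in Set.Iic x, Complex.exp (κ * y) * (V y * u y) := by
    have := integral_comp_neg_Ioi (-x) (fun y : ℝ => Complex.exp (κ * y) * (V y * u y))
    rw [neg_neg] at this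
    rw [← this]
    congr 1
    ext y
    push_cast
    rw [mul_neg]
  rw [h3] at h2
  have h4 : κ * ((-x : ℝ) : ℂ) = -κ * x := by push_cast; ring
  rw [h4] at h2
  rw [EvansFunction.greenIntegral_eq hb hκ hi]
  -- Adding the tail equations from the two ends cancels `u'` and expresses `2κu` by the two
  -- half-line integrals.
  have h5 : 1 / (2 * κ) * (2 * κ) = 1 := by field_simp
  generalize 1 / (2 * κ) = d at *
  linear_combination -d * h1 - d * h2 + u x * h5

end Green

/-! ### The weighted space `X` and Cauchy–Schwarz. -/

section Weighted

variable {a : ℝ} {f : ℝ → ℂ}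

theorem measurable_weight (a : ℝ) :
    Measurable fun x : ℝ => ENNReal.ofReal (Real.exp (2 * a * |x|)) := by fun_prop

theorem weightedVolume_absolutelyContinuous (a : ℝ) : weightedVolume a ≪ volume :=
  withDensity_absolutelyContinuous _ _

theorem absolutelyContinuous_weightedVolume (a : ℝ) : volume ≪ weightedVolume a :=
  withDensity_absolutelyContinuous' (measurable_weight a).aemeasurable
    (Eventually.of_forall fun x => by simp [Real.exp_pos])

theorem memLp_weightedVolume_iff :
    MemLp f 2 (weightedVolume a) ↔ MemLp (fun x => (Real.exp (a * |x|) : ℂ) * f x) 2 volume := by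
  have hc : Continuous fun x : ℝ => (Real.exp (a * |x|) : ℂ) :=
    Complex.continuous_ofReal.comp (by fun_prop)
  have key : ∀ hf : AEStronglyMeasurable f volume,
      (MemLp f 2 (weightedVolume a) ↔
        MemLp (fun x => (Real.exp (a * |x|) : ℂ) * f x) 2 volume) := by
    intro hf
    have hm : AEStronglyMeasurable (fun x => (Real.exp (a * |x|) : ℂ) * f x) volume :=
      hc.aestronglyMeasurable.mul hf
    rw [memLp_two_iff_integrable_sq_norm (hf.mono_ac (weightedVolume_absolutelyContinuous a)),
      memLp_two_iff_integrable_sq_norm hm, weightedVolume,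
      integrable_withDensity_iff_integrable_smul' (measurable_weight a)
        (Eventually.of_forall fun x => ENNReal.ofReal_lt_top)]
    refine integrable_congr (Eventually.of_forall fun x => ?_)
    simp only [smul_eq_mul]
    rw [ENNReal.toReal_ofReal (Real.exp_pos _).le, norm_exp_mul_ofReal, mul_pow, ← Real.exp_nat_mul]
    congr 2
    push_cast; ring
  constructor
  · intro h
    exact (key (h.aestronglyMeasurable.mono_ac (absolutelyContinuous_weightedVolume a))).1 h
  · intro h
    exact (key (aestronglyMeasurable_of_exp_mul (c := fun x => a * |x|) (by fun_prop)
      h.aestronglyMeasurable)).2 h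

/-- Cauchy–Schwarz against `e^{-(c-d)|x|}`. It is applied with `c = 2a` to `V` and with `c = a` to
elements of `X`. -/
theorem integrable_exp_mul_of_memLp {c d : ℝ} (hcd : d < c)
    (hf : MemLp (fun x => (Real.exp (c * |x|) : ℂ) * f x) 2 volume) :
    Integrable fun x => (Real.exp (d * |x|) : ℂ) * f x := by
  have hg : MemLp (fun x : ℝ => Complex.exp (-(((c - d : ℝ) : ℂ) * (|x| : ℝ)))) 2 volume := by
    rw [memLp_two_iff_integrable_sq_norm (continuous_exp_neg_mul_abs _).aestronglyMeasurable]
    have h := (integrable_exp_neg_mul_abs (κ := ((2 * (c - d) : ℝ) : ℂ))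
      (by rw [Complex.ofReal_re]; linarith)).norm
    refine h.congr (Eventually.of_forall fun x => ?_)
    simp only
    rw [← norm_pow, ← Complex.exp_nat_mul]
    congr 2
    push_cast; ring
  refine (hg.integrable_mul hf).congr (Eventually.of_forall fun x => ?_)
  simp only [Pi.mul_apply]
  rw [← mul_assoc, Complex.ofReal_exp, Complex.ofReal_exp, ← Complex.exp_add]
  congr 2
  push_cast; ring

end Weighted

/-! ### The Evans function and its zeros. -/

section Evans

variable {V : ℝ → ℂ} {a b : ℝ} {k κ : ℂ}

/-- The Jost solution at `-∞`. -/
def jostSolutionLeft (V : ℝ → ℂ) (κ : ℂ) (x : ℝ) : ℂ := jostSolution (fun y => V (-y)) κ (-x)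

/-- The Evans function in the coordinate `k = √lam`. -/
def evans (V : ℝ → ℂ) (k : ℂ) : ℂ :=
  wronskian (jostSolution V (Complex.I * k)) (jostSolutionLeft V (Complex.I * k)) 0

theorem wronskian_comp_neg (u v : ℝ → ℂ) (x : ℝ) :
    wronskian (fun x => u (-x)) (fun x => v (-x)) x = -wronskian u v (-x) := by
  rw [wronskian, wronskian, deriv_comp_neg_apply, deriv_comp_neg_apply]
  ring

theorem isMuMinus_jostSolutionLeft (hb : 0 < b) (hκ : -b < (Complex.I * k).re)
    (hV : Integrable (fun x : ℝ => (Real.exp (2 * b * |x|) : ℂ) * V x)) :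
    IsMuMinus V k (jostSolutionLeft V (Complex.I * k)) :=
  (isMuPlus_jostSolution hb hκ (integrable_exp_mul_comp_neg hV)).comp_neg
    (locallyIntegrable_of_exp_mul hV)

theorem differentiableOn_evans (hb : 0 < b)
    (hV : Integrable (fun x : ℝ => (Real.exp (2 * b * |x|) : ℂ) * V x)) :
    DifferentiableOn ℂ (evans V) {k : ℂ | k.im < b} := by
  have hV' := integrable_exp_mul_comp_neg hV
  have hmaps : Set.MapsTo (fun k : ℂ => Complex.I * k) {k : ℂ | k.im < b} {κ : ℂ | -b < κ.re} := by
    intro k hk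
    have : k.im < b := hk
    simpa using this
  have hI : DifferentiableOn ℂ (fun k : ℂ => Complex.I * k) {k : ℂ | k.im < b} := by fun_prop
  have d1 := (differentiableOn_jostAmplitude hb hV 0).comp hI hmaps
  have d2 := (differentiableOn_jostSlope hb hV 0).comp hI hmaps
  have d3 := (differentiableOn_jostAmplitude hb hV' 0).comp hI hmaps
  have d4 := (differentiableOn_jostSlope hb hV' 0).comp hI hmaps
  refine ((d1.mul (d4.sub (hI.mul d3)).neg).sub ((d2.sub (hI.mul d1)).mul d3)).congr fun k hk => ?_
  have hl : deriv (jostSolutionLeft V (Complex.I * k)) 0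
      = -deriv (jostSolution (fun y => V (-y)) (Complex.I * k)) (-0) := deriv_comp_neg_apply _ 0
  rw [evans, wronskian, hl, neg_zero, deriv_jostSolution hb (hmaps hk) hV',
    deriv_jostSolution hb (hmaps hk) hV, jostSolutionLeft, neg_zero, jostSolution, jostSolution]
  simp [Function.comp_def]

theorem evans_eq_zero_of_isGeneralizedEigenvalue (hb : 0 < b) (hba : b < a) (hk : k ≠ 0)
    (hκ : -b < (Complex.I * k).re)
    (hV : Integrable (fun x : ℝ => (Real.exp (2 * b * |x|) : ℂ) * V x))
    (h : IsGeneralizedEigenvalue a V k) : evans V k = 0 := by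
  obtain ⟨φ, hφ0, hφ⟩ := h
  have hV' := integrable_exp_mul_comp_neg hV
  have hVl := locallyIntegrable_of_exp_mul hV
  have hκ0 : Complex.I * k ≠ 0 := mul_ne_zero Complex.I_ne_zero hk
  have hi : Integrable fun y : ℝ => (Real.exp (b * |y|) : ℂ) * (φ : ℝ → ℂ) y :=
    integrable_exp_mul_of_memLp hba (memLp_weightedVolume_iff.1 (Lp.memLp φ))
  set κ := Complex.I * k with hκdef
  set u := greenIntegral κ φ with hu
  have hφu : ∀ᵐ x, (φ : ℝ → ℂ) x = V x * u x := by
    filter_upwards [hφ] with x hx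
    rw [continuedResolvent_eq_greenIntegral hb hk hκ hi] at hx
    exact sub_eq_zero.1 hx
  have huR : IsRightJost V κ b u := isRightJost_greenIntegral hb hκ hκ0 hi hφu
  have huL : IsRightJost (fun x => V (-x)) κ b (fun x => u (-x)) := by
    have e : (fun x => u (-x)) = greenIntegral κ (fun y => (φ : ℝ → ℂ) (-y)) :=
      funext fun x => (greenIntegral_comp_neg κ _ x).symm
    rw [e]
    refine isRightJost_greenIntegral hb hκ hκ0 (integrable_exp_mul_abs_comp_neg hi) ?_
    have := (Measure.measurePreserving_neg (volume : Measure ℝ)).quasiMeasurePreserving.ae hφu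
    filter_upwards [this] with x hx
    rw [greenIntegral_comp_neg]
    exact hx
  have hW1 := fun x => (isRightJost_jostSolution hb hκ hV).wronskian_eq_zero hVl hκ huR x
  have hW2 : ∀ x, wronskian (jostSolutionLeft V κ) u x = 0 := by
    intro x
    have h1 := (isRightJost_jostSolution hb hκ hV').wronskian_eq_zero
      (locallyIntegrable_comp_neg hVl) hκ huL (-x)
    have h2 := wronskian_comp_neg (jostSolution (fun x => V (-x)) κ) (fun x => u (-x)) x
    rw [h1, neg_zero] at h2
    simp only [neg_neg] at h2
    exact h2
  -- If `u` vanished identically, so would `φ = V u`.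
  have hne : ∃ x, u x ≠ 0 := by
    by_contra! hz
    apply hφ0
    rw [Lp.eq_zero_iff_ae_eq_zero]
    refine (weightedVolume_absolutelyContinuous a).ae_le ?_
    filter_upwards [hφu] with x hx
    rw [hx, hz x, mul_zero]; rfl
  obtain ⟨x, hx⟩ := hne
  have hsp := (isRightJost_jostSolution hb hκ hV).isSolution hκ (I_mul_sq k)
  have hsm := (isMuMinus_jostSolutionLeft hb hκ hV).solution
  rw [evans, wronskian_eq hVl hsp hsm 0 x]
  have h1 := hW1 x
  have h2 := hW2 x
  rw [wronskian] at h1 h2 ⊢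
  -- The identity is `u W(μ₊, μ₋) = μ₋ W(μ₊, u) - μ₊ W(μ₋, u)`.
  apply mul_left_cancel₀ hx
  linear_combination jostSolutionLeft V (Complex.I * k) x * h1 - jostSolution V (Complex.I * k) x * h2

theorem isGeneralizedEigenvalue_of_evans_eq_zero (hb : 0 < b) (hba : b < a) (hk : k ≠ 0)
    (hκ : -b < (Complex.I * k).re)
    (hV2 : MemLp (fun x : ℝ => (Real.exp (2 * a * |x|) : ℂ) * V x) 2 volume)
    (hV : Integrable (fun x : ℝ => (Real.exp (2 * b * |x|) : ℂ) * V x))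
    (h : evans V k = 0) : IsGeneralizedEigenvalue a V k := by
  have hV' := integrable_exp_mul_comp_neg hV
  have hVl := locallyIntegrable_of_exp_mul hV
  have hκ0 : Complex.I * k ≠ 0 := mul_ne_zero Complex.I_ne_zero hk
  have hmp := isMuPlus_jostSolution hb hκ hV
  have hml := isMuMinus_jostSolutionLeft hb hκ hV
  have hneL : ∃ x, jostSolutionLeft V (Complex.I * k) x ≠ 0 := by
    obtain ⟨x, hx⟩ := (hml.comp_neg hVl).exists_ne_zero
    exact ⟨-x, hx⟩
  -- Proportionality to `μ₋` makes `μ₊` outgoing at `-∞` as well and bounds it by a multiple of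
  -- `e^{b|x|}` on the whole line.
  obtain ⟨c, hc⟩ := exists_eq_const_mul_of_wronskian_eq_zero hVl hmp.solution hml.solution h hneL
  have huR := isRightJost_jostSolution hb hκ hV
  set κ := Complex.I * k with hκdef
  set u := jostSolution V κ with hu
  have huL : IsRightJost (fun x => V (-x)) κ b (fun x => u (-x)) := by
    have e : (fun x => u (-x)) = fun x => c * jostSolution (fun x => V (-x)) κ x := by
      ext x
      rw [hc (-x), jostSolutionLeft, neg_neg]
    rw [e]
    exact (isRightJost_jostSolution hb hκ hV').const_mul c
  have hbound : ∃ C : ℝ, ∀ x, ‖u x‖ ≤ C * Real.exp (b * |x|) := by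
    obtain ⟨C, hC⟩ := huR.bound
    obtain ⟨D, hD⟩ := huL.bound
    refine ⟨max C D, fun x => ?_⟩
    rcases le_total 0 x with hx | hx
    · rw [abs_of_nonneg hx]
      refine (hC x hx).trans ?_
      gcongr
      exact le_max_left C D
    · rw [abs_of_nonpos hx]
      have := hD (-x) (by linarith)
      rw [neg_neg] at this
      refine this.trans ?_
      gcongr
      exact le_max_right C D
  obtain ⟨C, hC⟩ := hbound
  have huc : Continuous u := huR.differentiable.continuous
  have hVm := hVl.aestronglyMeasurable
  have hLp : MemLp (fun x => (Real.exp (a * |x|) : ℂ) * (V x * u x)) 2 volume := by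
    have hcont : Continuous fun x : ℝ => (Real.exp (a * |x|) : ℂ) :=
      Complex.continuous_ofReal.comp (by fun_prop)
    refine hV2.of_le_mul (c := C)
      (hcont.aestronglyMeasurable.mul (hVm.mul huc.aestronglyMeasurable))
      (Eventually.of_forall fun x => ?_)
    rw [norm_exp_mul_ofReal, norm_exp_mul_ofReal, norm_mul]
    have h1 := hC x
    have hC0 : 0 ≤ C := by
      by_contra! hneg
      have := (norm_nonneg _).trans h1
      nlinarith [Real.exp_pos (b * |x|)]
    -- The weight of `X` and the growth of `u` together cost `a + b < 2a`, which the hypothesis on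
    -- `V` pays for.
    have h2 : Real.exp (a * |x|) * Real.exp (b * |x|) ≤ Real.exp (2 * a * |x|) := by
      rw [← Real.exp_add]
      apply Real.exp_le_exp.2
      nlinarith [abs_nonneg x]
    calc _ ≤ Real.exp (a * |x|) * (‖V x‖ * (C * Real.exp (b * |x|))) := by gcongr
      _ = (Real.exp (a * |x|) * Real.exp (b * |x|)) * (C * ‖V x‖) := by ring
      _ ≤ Real.exp (2 * a * |x|) * (C * ‖V x‖) := by gcongr
      _ = _ := by ring
  have hi : Integrable fun x : ℝ => (Real.exp (b * |x|) : ℂ) * (V x * u x) :=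
    integrable_exp_mul_of_memLp hba hLp
  have hgreen := huR.greenIntegral_eq hb hκ hκ0 huL hi
  have hLpw : MemLp (fun x => V x * u x) 2 (weightedVolume a) := memLp_weightedVolume_iff.2 hLp
  set φ : testSpace a := hLpw.toLp with hφ
  have hφae : (φ : ℝ → ℂ) =ᵐ[volume] fun x => V x * u x :=
    (absolutelyContinuous_weightedVolume a).ae_le hLpw.coeFn_toLp
  have hiφ : Integrable fun x : ℝ => (Real.exp (b * |x|) : ℂ) * (φ : ℝ → ℂ) x :=
    hi.congr (hφae.mono fun x hx => by simp only [hx])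
  have hgφ : ∀ x, greenIntegral κ φ x = u x := fun x => by
    rw [greenIntegral_congr_ae hφae, hgreen]
  refine ⟨φ, fun hzero => ?_, ?_⟩
  · have h0 : (φ : ℝ → ℂ) =ᵐ[volume] fun _ => 0 :=
      (absolutelyContinuous_weightedVolume a).ae_le ((Lp.eq_zero_iff_ae_eq_zero).1 hzero)
    -- If `φ` were zero, its Green integral, which is `μ₊`, would vanish identically.
    obtain ⟨x, hx⟩ := hmp.exists_ne_zero
    apply hx
    rw [← hgφ x, greenIntegral_congr_ae h0]
    simp [greenIntegral]
  · filter_upwards [hφae] with x hx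
    rw [continuedResolvent_eq_greenIntegral hb hk hκ hiφ, hgφ, hx, sub_self]

theorem exists_between_im (ha : 0 < a) (hk : k.im < a) :
    ∃ b, 0 < b ∧ b < a ∧ k.im < b := by
  obtain ⟨b, h1, h2⟩ := exists_between (max_lt ha hk)
  exact ⟨b, (le_max_left _ _).trans_lt h1, h2, (le_max_right _ _).trans_lt h1⟩

theorem im_lt_of_mem (ha : 0 < a) (hk : k ∈ firstSheet ∪ surfaceP a) : k.im < a := by
  rcases hk with h | h
  · exact lt_trans (show k.im < 0 from h) ha
  · exact h.2

end Evans

end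

end EvansFunction

theorem corollary4p2 (a : ℝ) (ha : 0 < a) (V : ℝ → ℂ)
    (hV : MemLp (fun x : ℝ => (Real.exp (2 * a * |x|) : ℂ) * V x) 2 volume) :
    -- on the first sheet the solutions defining the Evans function exist and are unique
    (∀ k ∈ EvansFunction.firstSheet,
      (∃! u : ℝ → ℂ, EvansFunction.IsMuPlus V k u) ∧
      (∃! v : ℝ → ℂ, EvansFunction.IsMuMinus V k v)) ∧
    -- and the Evans function, their Wronskian, continues analytically
    ∃ F : ℂ → ℂ,
      AnalyticOnNhd ℂ F (EvansFunction.firstSheet ∪ EvansFunction.surfaceP a) ∧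
      (∀ k ∈ EvansFunction.firstSheet, ∀ u v : ℝ → ℂ,
        EvansFunction.IsMuPlus V k u → EvansFunction.IsMuMinus V k v →
          ∀ x : ℝ, F k = EvansFunction.wronskian u v x) ∧
      (∀ k ∈ EvansFunction.firstSheet ∪ EvansFunction.surfaceP a, k ≠ 0 →
        (F k = 0 ↔ EvansFunction.IsGeneralizedEigenvalue a V k)) := by
  have hVb : ∀ b, b < a → Integrable (fun x : ℝ => (Real.exp (2 * b * |x|) : ℂ) * V x) :=
    fun b hb => EvansFunction.integrable_exp_mul_of_memLp (by linarith) hV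
  have hVl := EvansFunction.locallyIntegrable_of_exp_mul (hVb (a / 2) (by linarith))
  -- The exponent `b` varies with the point, because `e^{2a|x|} V` itself need not be integrable. As
  -- `evans V` does not involve `b`, the local statements refer to one function.
  have hex : ∀ k ∈ EvansFunction.firstSheet ∪ EvansFunction.surfaceP a, ∃ b, 0 < b ∧ b < a ∧
      k.im < b ∧ -b < (Complex.I * k).re := by
    intro k hk
    obtain ⟨b, h1, h2, h3⟩ := EvansFunction.exists_between_im ha (EvansFunction.im_lt_of_mem ha hk)
    exact ⟨b, h1, h2, h3, by simpa using h3⟩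
  have hsol : ∀ k ∈ EvansFunction.firstSheet,
      EvansFunction.IsMuPlus V k (EvansFunction.jostSolution V (Complex.I * k)) ∧
      EvansFunction.IsMuMinus V k (EvansFunction.jostSolutionLeft V (Complex.I * k)) := by
    intro k hk
    obtain ⟨b, hb, hba, -, hκ⟩ := hex k (Or.inl hk)
    exact ⟨EvansFunction.isMuPlus_jostSolution hb hκ (hVb b hba),
      EvansFunction.isMuMinus_jostSolutionLeft hb hκ (hVb b hba)⟩
  refine ⟨fun k hk => ⟨⟨_, (hsol k hk).1, fun u hu => hu.unique hVl hk (hsol k hk).1⟩,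
    ⟨_, (hsol k hk).2, fun v hv => hv.unique hVl hk (hsol k hk).2⟩⟩,
    EvansFunction.evans V, fun k hk => ?_, fun k hk u v hu hv x => ?_, fun k hk hk0 => ?_⟩
  · obtain ⟨b, hb, hba, hkb, -⟩ := hex k hk
    exact (EvansFunction.differentiableOn_evans hb (hVb b hba)).analyticAt
      ((isOpen_lt Complex.continuous_im continuous_const).mem_nhds hkb)
  · rw [hu.unique hVl hk (hsol k hk).1, hv.unique hVl hk (hsol k hk).2]
    exact EvansFunction.wronskian_eq hVl (hsol k hk).1.solution (hsol k hk).2.solution 0 x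
  · obtain ⟨b, hb, hba, -, hκ⟩ := hex k hk
    exact ⟨EvansFunction.isGeneralizedEigenvalue_of_evans_eq_zero hb hba hk0 hκ hV (hVb b hba),
      EvansFunction.evans_eq_zero_of_isGeneralizedEigenvalue hb hba hk0 hκ (hVb b hba)⟩
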